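/- Let $\mathcal H$ be a finite-dimensional complex Hilbert space and let $\rho_1,\rho_2$ be density operators on $\mathcal H$ (positive semidefinite, trace one). Write $D(\rho,\sigma)=\tfrac12\operatorname{tr}|\rho-\sigma|$ with $|\chi|=\sqrt{\chi\chi^\dagger}$ for the trace distance and $\operatorname{supp}\rho=(\ker\rho)^\perp$. For a density operator $\rho$ let $$\mathcal Q_\rho=\{|\phi\rangle\langle\phi| : \|\phi\|=1,\ \exists p>0:\ \rho-p|\phi\rangle\langle\phi|\ge 0\},$$ and let $W=\inf\{D(P_1,P_2): P_1\in\mathcal Q_{\rho_1},\,P_2\in\mathcal Q_{\rho_2}\}$ be the worst-case distinguishability of $\rho_1$ and $\rho_2$. For a completely positive trace preserving (CPTP) linear map $\Lambda\colon L(\mathcal H)\to L(\mathcal K)$, with $\mathcal K$ a finite-dimensional complex Hilbert space, let $\mathrm{Pur}(\Lambda)$ be the set of density operators $\rho$ on $\mathcal H$ with $\operatorname{tr}(\Lambda[\rho]^2)=1$. Then: 1. For every such $\mathcal K$ and every CPTP map $\Lambda\colon L(\mathcal H)\to L(\mathcal K)$ with $\{\rho_1,\rho_2\}\subset\mathrm{Pur}(\Lambda)$,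 $D(\Lambda[\rho_1],\Lambda[\rho_2])\le W$; and $$W=\max_\Lambda D(\Lambda[\rho_1],\Lambda[\rho_2]),$$ the maximum being over all finite-dimensional $\mathcal K$ and all CPTP maps $\Lambda\colon L(\mathcal H)\to L(\mathcal K)$ with $\{\rho_1,\rho_2\}\subset\mathrm{Pur}(\Lambda)$. 2. Put $r_i=\dim\operatorname{supp}\rho_i$ and $m=\min(r_1,r_2)$. There are Jordan bases of $\operatorname{supp}\rho_1$ and $\operatorname{supp}\rho_2$, i.e. orthonormal bases $(\psi_1^k)_{k\le r_1}$ and $(\psi_2^l)_{l\le r_2}$ with $\langle\psi_1^k|\psi_2^l\rangle=0$ for $k\ne l$ and $\langle\psi_1^k|\psi_2^k\rangle=\cos\vartheta_k$, $\vartheta_k\in[0,\pi/2]$, for $k\le m$. For all Jordan bases, $W=\min_{k\le m}\sin\vartheta_k$. 3. Take any such Jordan bases, and let $\varphi=\arcsin W$. For $k\le m$ let $\psi_\perp^k=(\psi_2^k-\cos\vartheta_k\,\psi_1^k)/\sin\vartheta_k$ (and $\psi_\perp^k=0$ if $\vartheta_k=0$), let $a_k=\tan\varphi\cot\vartheta_k$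 and $b_k=\sin\varphi/\sin\vartheta_k$ (and $a_k=b_k=1$ if $\vartheta_k=\varphi$), and $$A_1^k=|\psi_1^k\rangle\langle\psi_1^k|+a_k|\psi_\perp^k\rangle\langle\psi_\perp^k|,\qquad A_2^k=\Bigl(\sqrt{1-b_k^2}\,|\psi_1^k\rangle+\sqrt{b_k^2-a_k^2}\,|\psi_\perp^k\rangle\Bigr)\langle\psi_\perp^k|,$$ $$A_3=1-\sum_kA_1^{k\dagger}A_1^k-\sum_kA_2^{k\dagger}A_2^k,\qquad \tilde\Omega[\chi]=\sum_kA_1^k\chi A_1^{k\dagger}+\sum_kA_2^k\chi A_2^{k\dagger}+A_3\chi A_3^\dagger .$$ Then $\tilde\Omega$ is CPTP. Moreover, for every finite-dimensional complex Hilbert space $\mathcal K$ of dimension at least $2$ there are a CPTP map $\tilde E\colon L(\mathcal H)\to L(\mathcal H\otimes\mathcal K)$, an orthonormal basis $(|k\rangle)$ of $\mathcal H$, real numbers $p_{i,k}$ and unit vectors $\phi_1,\phi_2\in\mathcal K$ with $D(|\phi_1\rangle\langle\phi_1|,|\phi_2\rangle\langle\phi_2|)=W$, such that for $i=1,2$ $$(\tilde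 E\circ\tilde\Omega)[\rho_i]=\sum_kp_{i,k}\,|k\rangle\langle k|\otimes|\phi_i\rangle\langle\phi_i| ,$$ and $\Lambda=\operatorname{tr}_{\mathcal H}\circ\tilde E\circ\tilde\Omega$ is a CPTP map with $\Lambda[\rho_i]=|\phi_i\rangle\langle\phi_i|$ for $i=1,2$. In particular $\Lambda$ attains the maximum in 1. -/

import Mathlib

open Module
open scoped TensorProduct InnerProductSpace CStarAlgebra

universe u v

noncomputable section

namespace Purify

section Basic

variable {H : Type u} [NormedAddCommGroup H] [InnerProductSpace ℂ H] [CompleteSpace H]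
  [FiniteDimensional ℂ H]

/-- The trace of an operator on a finite-dimensional Hilbert space. -/
def opTrace (T : H →L[ℂ] H) : ℂ := LinearMap.trace ℂ H (T : H →ₗ[ℂ] H)

/-- Density operators: positive semidefinite operators of trace one. -/
def IsState (ρ : H →L[ℂ] H) : Prop := 0 ≤ ρ ∧ opTrace ρ = 1

/-- The operator `|φ⟩⟨φ|`. -/
def proj (φ : H) : H →L[ℂ] H := InnerProductSpace.rankOne ℂ φ φ

/-- The trace distance `½ tr |ρ - σ|`, where `|χ| = √(χ χ†)`. -/
def traceDist (ρ σ : H →L[ℂ] H) : ℝ :=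
  (1 / 2) * (opTrace (CFC.sqrt ((ρ - σ) * star (ρ - σ)))).re

/-- The support of an operator, i.e. the orthocomplement of its kernel. -/
def supp (ρ : H →L[ℂ] H) : Submodule ℂ H := (LinearMap.ker (ρ : H →ₗ[ℂ] H))ᗮ

/-- The pure states `|φ⟩⟨φ|` that can be part of an ensemble represented by `ρ`: those for which
`ρ - p |φ⟩⟨φ|` is positive semidefinite for some `p > 0`. -/
def ensemblePure (ρ : H →L[ℂ] H) : Set (H →L[ℂ] H) :=
  {P | ∃ φ : H, ‖φ‖ = 1 ∧ P = proj φ ∧ ∃ p : ℝ, 0 < p ∧ 0 ≤ ρ - (p : ℂ) • proj φ}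

/-- The worst-case distinguishability: the infimum of the trace distance over pairs of pure states
that can appear in ensembles represented by `ρ₁` and `ρ₂`, respectively. -/
def wcd (ρ₁ ρ₂ : H →L[ℂ] H) : ℝ :=
  sInf {t | ∃ P₁ ∈ ensemblePure ρ₁, ∃ P₂ ∈ ensemblePure ρ₂, t = traceDist P₁ P₂}

end Basic

section Maps

variable {H : Type u} [NormedAddCommGroup H] [InnerProductSpace ℂ H] [CompleteSpace H]
  [FiniteDimensional ℂ H]
  {K : Type v} [NormedAddCommGroup K] [InnerProductSpace ℂ K] [CompleteSpace K]
  [FiniteDimensional ℂ K]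

/-- Completely positive and trace preserving linear maps `L(H) → L(K)`. -/
def IsCPTP (Λ : (H →L[ℂ] H) →ₗ[ℂ] (K →L[ℂ] K)) : Prop :=
  (∃ Φ : (H →L[ℂ] H) →CP (K →L[ℂ] K), Φ.toLinearMap = Λ) ∧
    ∀ χ : H →L[ℂ] H, opTrace (Λ χ) = opTrace χ

/-- The states which get purified by `Λ`. -/
def Pur (Λ : (H →L[ℂ] H) →ₗ[ℂ] (K →L[ℂ] K)) : Set (H →L[ℂ] H) :=
  {ρ | IsState ρ ∧ opTrace (Λ ρ ^ 2) = 1}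

/-- The map `χ ↦ ∑ i, A i χ (A i)†` with Kraus operators `A i`. -/
def krausMap {ι : Type*} [Fintype ι] (A : ι → H →L[ℂ] K) :
    (H →L[ℂ] H) →ₗ[ℂ] (K →L[ℂ] K) where
  toFun χ := ∑ i, A i ∘L χ ∘L ContinuousLinearMap.adjoint (A i)
  map_add' χ χ' := by
    simp [ContinuousLinearMap.add_comp, ContinuousLinearMap.comp_add, Finset.sum_add_distrib]
  map_smul' c χ := by
    simp [ContinuousLinearMap.smul_comp, Finset.smul_sum]

instance instCompleteSpaceTensor : CompleteSpace (H ⊗[ℂ] K) := FiniteDimensional.complete ℂ _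

/-- The map `y ↦ x ⊗ y`. -/
def tensorLeft (x : H) : K →L[ℂ] H ⊗[ℂ] K :=
  LinearMap.toContinuousLinearMap (TensorProduct.mk ℂ H K x)

/-- The partial trace over the first factor, `T ↦ ∑ k, (⟨k| ⊗ 1) T (|k⟩ ⊗ 1)` for an orthonormal
basis `|k⟩` of `H`. -/
def partialTrace : (H ⊗[ℂ] K →L[ℂ] H ⊗[ℂ] K) →ₗ[ℂ] (K →L[ℂ] K) :=
  krausMap fun k : Fin (finrank ℂ H) =>
    ContinuousLinearMap.adjoint (tensorLeft (stdOrthonormalBasis ℂ H k))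

end Maps

section Jordan

variable {H : Type u} [NormedAddCommGroup H] [InnerProductSpace ℂ H]

/-- Jordan bases of two subspaces together with their Jordan angles: orthonormal bases `ψ₁`, `ψ₂`
with `⟨ψ₁ k, ψ₂ l⟩ = 0` for `k ≠ l` and `⟨ψ₁ k, ψ₂ k⟩ = cos (ϑ k)`, `0 ≤ ϑ k ≤ π / 2`. -/
structure JordanBases (A₁ A₂ : Submodule ℂ H) [FiniteDimensional ℂ H] where
  basis₁ : OrthonormalBasis (Fin (finrank ℂ A₁)) ℂ A₁
  basis₂ : OrthonormalBasis (Fin (finrank ℂ A₂)) ℂ A₂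
  angle : Fin (min (finrank ℂ A₁) (finrank ℂ A₂)) → ℝ
  angle_mem : ∀ k, angle k ∈ Set.Icc 0 (Real.pi / 2)
  inner_of_ne : ∀ (k : Fin (finrank ℂ A₁)) (l : Fin (finrank ℂ A₂)), (k : ℕ) ≠ (l : ℕ) →
    ⟪(basis₁ k : H), (basis₂ l : H)⟫_ℂ = 0
  inner_eq : ∀ k : Fin (min (finrank ℂ A₁) (finrank ℂ A₂)),
    ⟪(basis₁ (k.castLE (min_le_left _ _)) : H), (basis₂ (k.castLE (min_le_right _ _)) : H)⟫_ℂ =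
      (Real.cos (angle k) : ℂ)

namespace JordanBases

variable [FiniteDimensional ℂ H] {A₁ A₂ : Submodule ℂ H} (J : JordanBases A₁ A₂)
  (φ : ℝ) (k : Fin (min (finrank ℂ A₁) (finrank ℂ A₂)))

/-- The `k`-th Jordan vector of the first subspace, for `k` up to the smaller dimension. -/
def ψ₁ : H := J.basis₁ (k.castLE (min_le_left _ _))

/-- The `k`-th Jordan vector of the second subspace, for `k` up to the smaller dimension. -/
def ψ₂ : H := J.basis₂ (k.castLE (min_le_right _ _))

/-- The unit vector orthogonal to `ψ₁ k` with `ψ₂ k = cos (ϑ k) ψ₁ k + sin (ϑ k) ψ₁⊥ k`. If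
`ϑ k = 0`, then `ψ₁ k = ψ₂ k` span only a line, and this is the zero vector. -/
def ψPerp : H :=
  (((Real.sin (J.angle k))⁻¹ : ℝ) : ℂ) • (J.ψ₂ k - (Real.cos (J.angle k) : ℂ) • J.ψ₁ k)

/-- The coefficient `tan φ cot (ϑ k)`; it is `1` if the angle is not changed, `φ = ϑ k` (this
covers `φ = ϑ k = 0` and `φ = ϑ k = π / 2`, where the formula makes no sense). -/
def a : ℝ := if φ = J.angle k then 1 else Real.tan φ * Real.cot (J.angle k)

/-- The coefficient `sin φ / sin (ϑ k)`; it is `1` if the angle is not changed, `φ = ϑ k` (this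
covers `φ = ϑ k = 0`, where the formula makes no sense). -/
def b : ℝ := if φ = J.angle k then 1 else Real.sin φ / Real.sin (J.angle k)

/-- `A₁ᵏ = |ψ₁⟩⟨ψ₁| + a |ψ₁⊥⟩⟨ψ₁⊥|`. -/
def kraus₁ : H →L[ℂ] H := proj (J.ψ₁ k) + (J.a φ k : ℂ) • proj (J.ψPerp k)

/-- `A₂ᵏ = (√(1 - b²) |ψ₁⟩ + √(b² - a²) |ψ₁⊥⟩) ⟨ψ₁⊥|`. -/
def kraus₂ : H →L[ℂ] H :=
  InnerProductSpace.rankOne ℂ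
    ((Real.sqrt (1 - J.b φ k ^ 2) : ℂ) • J.ψ₁ k +
      (Real.sqrt (J.b φ k ^ 2 - J.a φ k ^ 2) : ℂ) • J.ψPerp k)
    (J.ψPerp k)

variable [CompleteSpace H]

/-- `A₃ = 1 - ∑ k, A₁ᵏ† A₁ᵏ - ∑ k, A₂ᵏ† A₂ᵏ`. -/
def kraus₃ : H →L[ℂ] H :=
  1 - ∑ k, star (J.kraus₁ φ k) * J.kraus₁ φ k - ∑ k, star (J.kraus₂ φ k) * J.kraus₂ φ k

/-- The map `Ω̃` that reduces all the Jordan angles to `φ`. -/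
def shrink : (H →L[ℂ] H) →ₗ[ℂ] (H →L[ℂ] H) :=
  krausMap (J.kraus₁ φ) + krausMap (J.kraus₂ φ) + krausMap (fun _ : Unit => J.kraus₃ φ)

end JordanBases

end Jordan

end Purify

end

set_option linter.unusedSectionVars false

/-! Upper bound. If `Λ` purifies `ρ` and `ρ ≥ p P` with `P` pure and `p > 0`, then `Λ ρ ≥ p Λ P`. A
pure state is extremal, so `Λ ρ = Λ P` (`eq_of_smul_le`, `apply_eq_of_mem_ensemblePure`). Hence `Λ
ρ₁`, `Λ ρ₂` are the images of every admissible pair `P₁`, `P₂`, and contractivity of the trace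
distance bounds their distance by that of each pair, hence by the infimum (`traceDist_le_wcd`).

Value. The admissible pure states are the unit vectors of the support (`mem_ensemblePure_iff`), and
two of them have distance `√(1 - |⟨x, y⟩|²)`. The infimum therefore asks for the largest overlap
between the supports, which Jordan bases diagonalise: it is the largest `cos ϑ_k` (`norm_inner_le`,
`isLeast_wcd`).

Attainment. With `φ = arcsin W`, the Kraus operators of `shrink` send each Jordan vector `ψ₂ k` to
multiples of `cos φ ψ₁ + sin φ ψPerp`, so all planes then carry the same angle. `encode` stores the
plane's label in the first factor and maps `ψ₁`, `ψPerp` to fixed orthonormal vectors `η`, `ζ` in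
the second. Tracing out the label leaves the pure states of `η` and `cos φ η + sin φ ζ`. Only the
larger support has vectors without a partner, so `encode` may replace these by the target vector of
that support. -/

namespace Purify

/-! ### Traces of positive operators and extremality of pure states. -/

section Trace

variable {H : Type u} [NormedAddCommGroup H] [InnerProductSpace ℂ H] [FiniteDimensional ℂ H]
  {K : Type v} [NormedAddCommGroup K] [InnerProductSpace ℂ K] [FiniteDimensional ℂ K]

variable [CompleteSpace H] [CompleteSpace K]

lemma opTrace_add (S T : H →L[ℂ] H) : opTrace (S + T) = opTrace S + opTrace T := by
  simp [opTrace]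

lemma opTrace_sub (S T : H →L[ℂ] H) : opTrace (S - T) = opTrace S - opTrace T := by
  simp [opTrace]

lemma opTrace_smul (c : ℂ) (T : H →L[ℂ] H) : opTrace (c • T) = c * opTrace T := by
  simp [opTrace]

lemma opTrace_sum {ι : Type*} (s : Finset ι) (T : ι → H →L[ℂ] H) :
    opTrace (∑ i ∈ s, T i) = ∑ i ∈ s, opTrace (T i) := by
  simp [opTrace]

lemma opTrace_comp_comm (A : H →L[ℂ] K) (B : K →L[ℂ] H) :
    opTrace (A ∘L B) = opTrace (B ∘L A) := by
  simp only [opTrace, ContinuousLinearMap.toLinearMap_comp]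
  exact LinearMap.trace_comp_comm' _ _

lemma opTrace_mul_comm (A B : H →L[ℂ] H) : opTrace (A * B) = opTrace (B * A) :=
  opTrace_comp_comm A B

lemma opTrace_rankOne (x y : H) : opTrace (InnerProductSpace.rankOne ℂ x y) = ⟪y, x⟫_ℂ :=
  InnerProductSpace.trace_rankOne x y

lemma opTrace_proj (x : H) : opTrace (proj x) = (‖x‖ : ℂ) ^ 2 := by
  simp [proj, opTrace_rankOne]

lemma opTrace_eq_sum_inner {ι : Type*} [Fintype ι] (b : OrthonormalBasis ι ℂ H) (T : H →L[ℂ] H) :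
    opTrace T = ∑ i, ⟪b i, T (b i)⟫_ℂ :=
  LinearMap.trace_eq_sum_inner _ b

lemma proj_apply (x y : H) : proj x y = ⟪x, y⟫_ℂ • x := rfl

lemma proj_nonneg (x : H) : 0 ≤ proj x :=
  (ContinuousLinearMap.nonneg_iff_isPositive _).2 (InnerProductSpace.isPositive_rankOne_self x)

lemma star_proj (x : H) : star (proj x) = proj x := by
  simp [proj, ContinuousLinearMap.star_eq_adjoint]

open scoped ComplexOrder in
lemma ofReal_smul_nonneg {r : ℝ} (hr : 0 ≤ r) {A : H →L[ℂ] H} (hA : 0 ≤ A) : 0 ≤ (r : ℂ) • A :=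
  (ContinuousLinearMap.nonneg_iff_isPositive _).2
    (((ContinuousLinearMap.nonneg_iff_isPositive _).1 hA).smul_of_nonneg (by exact_mod_cast hr))

lemma re_inner_nonneg {A : H →L[ℂ] H} (hA : 0 ≤ A) (x : H) : 0 ≤ (⟪x, A x⟫_ℂ).re :=
  ((ContinuousLinearMap.nonneg_iff_isPositive _).1 hA).re_inner_nonneg_right x

/-- Complete `x` to an orthonormal basis: the trace is a sum of nonnegative diagonal entries, one of
which belongs to `x`. -/
lemma re_inner_le_re_opTrace_of_norm_eq_one {A : H →L[ℂ] H} (hA : 0 ≤ A) {x : H} (hx : ‖x‖ = 1) :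
    (⟪x, A x⟫_ℂ).re ≤ (opTrace A).re := by
  have hne : x ≠ 0 := by rintro rfl; simp at hx
  have hpos : 0 < finrank ℂ H := by
    have : Nontrivial H := ⟨x, 0, hne⟩
    exact finrank_pos
  obtain ⟨b, hb⟩ := Orthonormal.exists_orthonormalBasis_extension_of_card_eq (𝕜 := ℂ) (E := H)
    (ι := Fin (finrank ℂ H)) (by simp) (v := fun _ => x) (s := {⟨0, hpos⟩}) (by
      refine ⟨fun i => by simpa using hx, fun i j hij => ?_⟩
      exact absurd (Subsingleton.elim i j) hij)
  have hb0 := hb ⟨0, hpos⟩ rfl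
  rw [opTrace_eq_sum_inner b, Complex.re_sum, ← hb0]
  exact Finset.single_le_sum (f := fun i => (⟪b i, A (b i)⟫_ℂ).re)
    (fun i _ => re_inner_nonneg hA _) (Finset.mem_univ _)

lemma re_inner_le_re_opTrace {A : H →L[ℂ] H} (hA : 0 ≤ A) (x : H) :
    (⟪x, A x⟫_ℂ).re ≤ (opTrace A).re * ‖x‖ ^ 2 := by
  rcases eq_or_ne x 0 with rfl | hx
  · simp
  have h := re_inner_le_re_opTrace_of_norm_eq_one hA (x := ((‖x‖⁻¹ : ℝ) : ℂ) • x) (by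
    rw [norm_smul]; simp [norm_ne_zero_iff.2 hx])
  rw [map_smul, inner_smul_left, inner_smul_right, Complex.conj_ofReal, ← mul_assoc,
    ← Complex.ofReal_mul, Complex.re_ofReal_mul] at h
  have hn : 0 < ‖x‖ := norm_pos_iff.2 hx
  calc (⟪x, A x⟫_ℂ).re = (‖x‖⁻¹ * ‖x‖⁻¹ * (⟪x, A x⟫_ℂ).re) * ‖x‖ ^ 2 := by field_simp
    _ ≤ _ := by gcongr

lemma opTrace_mul_proj (A : H →L[ℂ] H) (x : H) : opTrace (A * proj x) = ⟪x, A x⟫_ℂ := by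
  rw [ContinuousLinearMap.mul_def, proj, InnerProductSpace.comp_rankOne, opTrace_rankOne]

lemma exists_eq_sum_proj {B : H →L[ℂ] H} (hB : 0 ≤ B) :
    ∃ (m : ℕ) (w : Fin m → H), B = ∑ i, proj (w i) := by
  obtain ⟨m, w, h⟩ := ContinuousLinearMap.isPositive_iff_eq_sum_rankOne.1
    ((ContinuousLinearMap.nonneg_iff_isPositive _).1 hB)
  exact ⟨m, w, h⟩

/-- Writing `B` as a sum of `proj (w i)` reduces the bound to `⟨w, A w⟩ ≤ tr A ‖w‖²`. -/
lemma re_opTrace_mul_le {A B : H →L[ℂ] H} (hA : 0 ≤ A) (hB : 0 ≤ B) :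
    (opTrace (A * B)).re ≤ (opTrace A).re * (opTrace B).re := by
  obtain ⟨m, w, rfl⟩ := exists_eq_sum_proj hB
  rw [Finset.mul_sum, opTrace_sum, opTrace_sum, Complex.re_sum, Complex.re_sum, Finset.mul_sum]
  refine Finset.sum_le_sum fun i _ => ?_
  rw [opTrace_mul_proj, opTrace_proj]
  exact_mod_cast re_inner_le_re_opTrace hA (w i)

lemma eq_zero_of_opTrace_star_mul_self {A : H →L[ℂ] H} (hA : (opTrace (star A * A)).re ≤ 0) :
    A = 0 := by
  rw [opTrace_eq_sum_inner (stdOrthonormalBasis ℂ H), Complex.re_sum] at hA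
  have h1 : ∀ i, (⟪stdOrthonormalBasis ℂ H i, (star A * A) (stdOrthonormalBasis ℂ H i)⟫_ℂ).re =
      ‖A (stdOrthonormalBasis ℂ H i)‖ ^ 2 := fun i => by
    rw [ContinuousLinearMap.star_eq_adjoint, mul_apply_eq_comp,
      ContinuousLinearMap.adjoint_inner_right, inner_self_eq_norm_sq_to_K]
    norm_cast
  simp only [h1] at hA
  have h2 := (Finset.sum_eq_zero_iff_of_nonneg (fun i _ => sq_nonneg _)).1
    (le_antisymm hA (Finset.sum_nonneg fun i _ => sq_nonneg _))
  have h3 : ∀ i, A (stdOrthonormalBasis ℂ H i) = 0 := fun i => by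
    simpa using h2 i (Finset.mem_univ _)
  have h4 : (A : H →ₗ[ℂ] H) = 0 :=
    (stdOrthonormalBasis ℂ H).toBasis.ext fun i => by simpa using h3 i
  exact ContinuousLinearMap.coe_injective h4

/-- A state of purity one is extremal: it equals every state it dominates up to a factor. -/
lemma eq_of_smul_le {σ τ : H →L[ℂ] H} (hσ : IsState σ) (hσ2 : opTrace (σ ^ 2) = 1)
    (hτ : IsState τ) {p : ℝ} (hp : 0 < p) (h : 0 ≤ σ - (p : ℂ) • τ) : σ = τ := by
  -- This reads `1 - p tr(στ) ≤ 1 - p`, so `tr(στ) ≥ 1`. Together with `tr τ² ≤ 1` it gives `tr (σ -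
  -- τ)² ≤ 0`.
  have hR := re_opTrace_mul_le hσ.1 h
  have hττ := re_opTrace_mul_le hτ.1 hτ.1
  rw [mul_sub, mul_smul_comm, opTrace_sub, opTrace_sub, opTrace_smul, opTrace_smul, ← pow_two, hσ2,
    hσ.2, hτ.2] at hR
  rw [hτ.2] at hττ
  have h1 : 1 ≤ (opTrace (σ * τ)).re := by
    simp at hR
    nlinarith
  have hs : star (σ - τ) = σ - τ :=
    ((IsSelfAdjoint.of_nonneg hσ.1).sub (IsSelfAdjoint.of_nonneg hτ.1)).star_eq
  refine sub_eq_zero.1 (eq_zero_of_opTrace_star_mul_self ?_)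
  rw [hs, mul_sub, sub_mul, sub_mul, opTrace_sub, opTrace_sub, opTrace_sub, ← pow_two, hσ2,
    opTrace_mul_comm τ σ]
  simp at hττ ⊢
  linarith

end Trace

/-! ### The trace norm and the distance of pure states. -/

section TraceDist

variable {H : Type u} [NormedAddCommGroup H] [InnerProductSpace ℂ H] [FiniteDimensional ℂ H]
  [CompleteSpace H]

/-- The trace norm of a difference of positive operators is at most the sum of the traces. -/
lemma re_opTrace_sqrt_le {Y A B : H →L[ℂ] H} (hA : 0 ≤ A) (hB : 0 ≤ B) (hY : Y = A - B) :
    (opTrace (CFC.sqrt (Y * star Y))).re ≤ (opTrace A).re + (opTrace B).re := by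
  have hsa : IsSelfAdjoint Y :=
    hY ▸ (IsSelfAdjoint.of_nonneg hA).sub (IsSelfAdjoint.of_nonneg hB)
  have hsym : (Y : H →ₗ[ℂ] H).IsSymmetric := hsa.isSymmetric
  set b := hsym.eigenvectorBasis rfl
  set l := hsym.eigenvalues rfl
  have hb : ∀ i, Y (b i) = (l i : ℂ) • b i := hsym.apply_eigenvectorBasis rfl
  -- `S` is `|Y|`, written in an eigenbasis of `Y`. Its trace is then compared entry by entry, using
  -- `|a - b| ≤ a + b` for nonnegative `a`, `b`.
  set S : H →L[ℂ] H := ∑ i, ((|l i| : ℝ) : ℂ) • proj (b i)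
  have hSb : ∀ i, S (b i) = ((|l i| : ℝ) : ℂ) • b i := fun i => by
    simp [S, proj_apply, b.inner_eq_ite]
  have hS : 0 ≤ S := Finset.sum_nonneg fun i _ =>
    ofReal_smul_nonneg (abs_nonneg (l i)) (proj_nonneg _)
  have hSS : S * S = Y * star Y := by
    rw [hsa.star_eq]
    refine ContinuousLinearMap.coe_injective (b.toBasis.ext fun i => ?_)
    simp only [OrthonormalBasis.coe_toBasis, ContinuousLinearMap.coe_coe,
      mul_apply_eq_comp, hSb, hb, map_smul, smul_smul]
    rw [← Complex.ofReal_mul, ← Complex.ofReal_mul, abs_mul_abs_self]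
  rw [CFC.sqrt_unique hSS hS, opTrace_eq_sum_inner b, opTrace_eq_sum_inner b,
    opTrace_eq_sum_inner b, Complex.re_sum, Complex.re_sum, Complex.re_sum,
    ← Finset.sum_add_distrib]
  refine Finset.sum_le_sum fun i _ => ?_
  have h1 : l i = (⟪b i, A (b i)⟫_ℂ).re - (⟪b i, B (b i)⟫_ℂ).re := by
    rw [← Complex.sub_re, ← inner_sub_right, ← sub_apply, ← hY, hb,
      inner_smul_right]
    simp
  have hA' := re_inner_nonneg hA (b i)
  have hB' := re_inner_nonneg hB (b i)
  rw [hSb, inner_smul_right]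
  simp only [OrthonormalBasis.inner_eq_one, mul_one, Complex.ofReal_re]
  rw [h1]
  exact abs_le.2 ⟨by linarith, by linarith⟩

/-- The trace distance of two pure states. -/
lemma traceDist_proj {φ₁ φ₂ : H} (h₁ : ‖φ₁‖ = 1) (h₂ : ‖φ₂‖ = 1) :
    traceDist (proj φ₁) (proj φ₂) = √(1 - ‖⟪φ₁, φ₂⟫_ℂ‖ ^ 2) := by
  set c := ⟪φ₁, φ₂⟫_ℂ with hc
  have hle : ‖c‖ ≤ 1 := by simpa [h₁, h₂] using norm_inner_le_norm (𝕜 := ℂ) φ₁ φ₂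
  have h0 : 0 ≤ 1 - ‖c‖ ^ 2 := by nlinarith [norm_nonneg c]
  set s := √(1 - ‖c‖ ^ 2) with hs
  have hs2 : s * s = 1 - ‖c‖ ^ 2 := Real.mul_self_sqrt h0
  have h12 : ⟪φ₂, φ₁⟫_ℂ = starRingEnd ℂ c := (inner_conj_symm _ _).symm
  have h11 : ⟪φ₁, φ₁⟫_ℂ = 1 := by simp [inner_self_eq_norm_sq_to_K, h₁]
  have h22 : ⟪φ₂, φ₂⟫_ℂ = 1 := by simp [inner_self_eq_norm_sq_to_K, h₂]
  have hcc : c * starRingEnd ℂ c = ((‖c‖ ^ 2 : ℝ) : ℂ) := by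
    rw [Complex.mul_conj, Complex.normSq_eq_norm_sq]
  set X := proj φ₁ - proj φ₂ with hX
  have hXs : star X = X := by simp [hX, star_proj]
  have hX2 : ∀ x, X (X x) = ⟪φ₁, x⟫_ℂ • φ₁ + ⟪φ₂, x⟫_ℂ • φ₂ - (⟪φ₁, x⟫_ℂ * starRingEnd ℂ c) • φ₂
      - (⟪φ₂, x⟫_ℂ * c) • φ₁ := fun x => by
    simp only [hX, sub_apply, proj_apply, map_sub, map_smul, h11, h22, h12,
      ← hc]
    module
  -- The nonzero eigenvalues of `X` are `±s`, hence `X³ = s² X` and `|X| = s⁻¹ X²`. For `s = 0` the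
  -- operator `X` vanishes and the formula survives because `0⁻¹ = 0`.
  have hX3 : X * X * X = ((s * s : ℝ) : ℂ) • X := by
    ext x
    rw [mul_apply_eq_comp, mul_apply_eq_comp, hX2, smul_apply]
    have e1 : ⟪φ₁, X x⟫_ℂ = ⟪φ₁, x⟫_ℂ - ⟪φ₂, x⟫_ℂ * c := by
      simp [hX, proj_apply, ← hc, mul_comm, h₁]
    have e2 : ⟪φ₂, X x⟫_ℂ = ⟪φ₁, x⟫_ℂ * starRingEnd ℂ c - ⟪φ₂, x⟫_ℂ := by
      simp [hX, proj_apply, h12, h₂]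
    rw [e1, e2, hs2, Complex.ofReal_sub, ← hcc]
    simp only [hX, sub_apply, proj_apply, Complex.ofReal_one]
    module
  have htr : opTrace (X * X) = ((2 * (s * s) : ℝ) : ℂ) := by
    rw [hX, mul_sub, opTrace_sub, opTrace_mul_proj, opTrace_mul_proj]
    simp only [sub_apply, proj_apply, inner_sub_right, inner_smul_right, h11,
      h22, h12, ← hc]
    rw [hs2, mul_comm (starRingEnd ℂ c), hcc]
    push_cast
    ring
  have hXX : 0 ≤ X * X := by simpa [hXs] using star_mul_self_nonneg X
  have hsqrt : CFC.sqrt (X * star X) = ((s⁻¹ : ℝ) : ℂ) • (X * X) := by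
    have hs0 : 0 ≤ s⁻¹ := inv_nonneg.2 (Real.sqrt_nonneg _)
    refine CFC.sqrt_unique ?_ (ofReal_smul_nonneg hs0 hXX)
    rw [hXs, smul_mul_smul_comm, ← mul_assoc, hX3, smul_mul_assoc, smul_smul, ← Complex.ofReal_mul,
      ← Complex.ofReal_mul]
    rcases eq_or_ne s 0 with h | h
    · have : X = 0 := by
        refine eq_zero_of_opTrace_star_mul_self ?_
        rw [hXs, htr, h]
        simp
      simp [this]
    · rw [show s⁻¹ * s⁻¹ * (s * s) = 1 by field_simp]
      simp
  rw [traceDist, ← hX, hsqrt, opTrace_smul, htr, ← Complex.ofReal_mul, Complex.ofReal_re]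
  rcases eq_or_ne s 0 with h | h
  · simp [h]
  · field_simp

end TraceDist

/-! ### Completely positive maps, Kraus maps and the partial trace. -/

section Maps

variable {H : Type*} [NormedAddCommGroup H] [InnerProductSpace ℂ H] [CompleteSpace H]
  [FiniteDimensional ℂ H]
  {K : Type*} [NormedAddCommGroup K] [InnerProductSpace ℂ K] [CompleteSpace K]
  [FiniteDimensional ℂ K]
  {L : Type*} [NormedAddCommGroup L] [InnerProductSpace ℂ L] [CompleteSpace L]
  [FiniteDimensional ℂ L]

/-- Complete positivity, as a predicate on linear maps. -/
def IsCP (Λ : (H →L[ℂ] H) →ₗ[ℂ] (K →L[ℂ] K)) : Prop :=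
  ∃ Φ : (H →L[ℂ] H) →CP (K →L[ℂ] K), Φ.toLinearMap = Λ

lemma isCP_iff {Λ : (H →L[ℂ] H) →ₗ[ℂ] (K →L[ℂ] K)} : IsCP Λ ↔
    ∀ (k : ℕ) (M : CStarMatrix (Fin k) (Fin k) (H →L[ℂ] H)), 0 ≤ M → 0 ≤ M.map Λ :=
  ⟨fun ⟨Φ, h⟩ => h ▸ Φ.map_cstarMatrix_nonneg', fun h => ⟨⟨Λ, h⟩, rfl⟩⟩

lemma IsCP.add {Λ Λ' : (H →L[ℂ] H) →ₗ[ℂ] (K →L[ℂ] K)} (h : IsCP Λ) (h' : IsCP Λ') :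
    IsCP (Λ + Λ') :=
  isCP_iff.2 fun k M hM => add_nonneg (isCP_iff.1 h k M hM) (isCP_iff.1 h' k M hM)

lemma IsCP.comp {Λ : (H →L[ℂ] H) →ₗ[ℂ] (K →L[ℂ] K)} {Λ' : (K →L[ℂ] K) →ₗ[ℂ] (L →L[ℂ] L)}
    (h' : IsCP Λ') (h : IsCP Λ) : IsCP (Λ' ∘ₗ Λ) :=
  isCP_iff.2 fun k M hM => isCP_iff.1 h' k _ (isCP_iff.1 h k M hM)

lemma IsCP.nonneg {Λ : (H →L[ℂ] H) →ₗ[ℂ] (K →L[ℂ] K)} (h : IsCP Λ) {A : H →L[ℂ] H}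
    (hA : 0 ≤ A) : 0 ≤ Λ A := by
  obtain ⟨Φ, rfl⟩ := h
  exact map_nonneg Φ hA

/-- A matrix of operators `|v i⟩⟨v j|` is positive. -/
lemma cstarMatrix_rankOne_nonneg {k : ℕ} (w : Fin k → K) :
    0 ≤ (CStarMatrix.ofMatrix fun i j => InnerProductSpace.rankOne ℂ (w i) (w j) :
      CStarMatrix (Fin k) (Fin k) (K →L[ℂ] K)) := by
  rcases subsingleton_or_nontrivial K with hK | hK
  · refine le_of_eq (CStarMatrix.ext fun i j => ContinuousLinearMap.ext fun x => ?_)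
    exact Subsingleton.elim _ _
  obtain ⟨x, hx⟩ := exists_norm_eq K zero_le_one
  rcases Nat.eq_zero_or_pos k with rfl | hk
  · exact le_of_eq (CStarMatrix.ext fun i => i.elim0)
  -- Only row zero of `N` is nonzero. With `‖x‖ = 1` the entries of `star N * N` are `|w i⟩⟨x|x⟩⟨w
  -- j| = |w i⟩⟨w j|`.
  set N : CStarMatrix (Fin k) (Fin k) (K →L[ℂ] K) := CStarMatrix.ofMatrix fun i j =>
    if i = ⟨0, hk⟩ then InnerProductSpace.rankOne ℂ x (w j) else 0
  have hN : ∀ i j, N i j = if i = ⟨0, hk⟩ then InnerProductSpace.rankOne ℂ x (w j) else 0 :=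
    fun _ _ => rfl
  convert star_mul_self_nonneg N using 1
  refine CStarMatrix.ext fun i j => ?_
  rw [CStarMatrix.mul_apply, Finset.sum_eq_single ⟨0, hk⟩]
  · change InnerProductSpace.rankOne ℂ (w i) (w j) = star (N ⟨0, hk⟩ i) * N ⟨0, hk⟩ j
    rw [hN ⟨0, hk⟩ i, hN ⟨0, hk⟩ j]
    simp [ContinuousLinearMap.star_eq_adjoint, ContinuousLinearMap.mul_def,
      InnerProductSpace.rankOne_comp_rankOne, hx]
  · intro l _ hl
    rw [hN l j, if_neg hl, mul_zero]
  · simp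

lemma cstarMatrix_sum_apply {ι : Type*} {k : ℕ} (s : Finset ι)
    (f : ι → CStarMatrix (Fin k) (Fin k) (K →L[ℂ] K)) (i j : Fin k) :
    (∑ t ∈ s, f t) i j = ∑ t ∈ s, f t i j :=
  Matrix.sum_apply i j s f

/-- Positive matrices are generated additively by the `star N * N`. Inserting a resolution of the
identity between the two factors turns their images into sums of matrices `|v i⟩⟨v j|`, which
`cstarMatrix_rankOne_nonneg` covers. -/
lemma isCP_krausMap {ι : Type*} [Fintype ι] (A : ι → H →L[ℂ] K) : IsCP (krausMap A) := by
  refine isCP_iff.2 fun k M hM => ?_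
  have hmap : ∀ M N : CStarMatrix (Fin k) (Fin k) (H →L[ℂ] H),
      (M + N).map (krausMap A) = M.map (krausMap A) + N.map (krausMap A) := fun M N =>
    CStarMatrix.ext fun i j => map_add (krausMap A) (M i j) (N i j)
  rw [StarOrderedRing.nonneg_iff] at hM
  induction hM using AddSubmonoid.closure_induction with
  | zero => exact le_of_eq (CStarMatrix.ext fun i j => (map_zero (krausMap A)).symm)
  | add M N _ _ hM hN => exact hmap M N ▸ add_nonneg hM hN
  | mem M hM =>
  obtain ⟨N, rfl⟩ := hM
  set b := stdOrthonormalBasis ℂ H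
  have key : (star N * N).map (krausMap A) = ∑ t : ι, ∑ l, ∑ m,
      (CStarMatrix.ofMatrix fun i j => InnerProductSpace.rankOne ℂ (A t (star (N l i) (b m)))
        (A t (star (N l j) (b m))) : CStarMatrix (Fin k) (Fin k) (K →L[ℂ] K)) := by
    refine CStarMatrix.ext fun i j => ?_
    simp only [cstarMatrix_sum_apply]
    change ∑ t, A t ∘L (∑ l, star (N l i) * N l j) ∘L ContinuousLinearMap.adjoint (A t) =
      ∑ t, ∑ l, ∑ m, InnerProductSpace.rankOne ℂ (A t (star (N l i) (b m)))
        (A t (star (N l j) (b m)))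
    refine Finset.sum_congr rfl fun t _ => ?_
    ext x
    simp only [ContinuousLinearMap.comp_apply, sum_apply, map_sum]
    refine Finset.sum_congr rfl fun l _ => ?_
    rw [mul_apply_eq_comp, ← b.sum_repr' (N l j (ContinuousLinearMap.adjoint (A t) x)), map_sum,
      map_sum]
    refine Finset.sum_congr rfl fun m _ => ?_
    rw [InnerProductSpace.rankOne_apply, ContinuousLinearMap.star_eq_adjoint,
      ContinuousLinearMap.star_eq_adjoint, map_smul, map_smul,
      ← ContinuousLinearMap.adjoint_inner_right (A t), ContinuousLinearMap.adjoint_inner_left]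
  rw [key]
  exact Finset.sum_nonneg fun t _ => Finset.sum_nonneg fun l _ => Finset.sum_nonneg fun m _ =>
    cstarMatrix_rankOne_nonneg fun i => A t (star (N l i) (b m))

lemma opTrace_krausMap {ι : Type*} [Fintype ι] (A : ι → H →L[ℂ] K) (χ : H →L[ℂ] H) :
    opTrace (krausMap A χ) =
      opTrace ((∑ i, ContinuousLinearMap.adjoint (A i) ∘L A i) * χ) := by
  simp only [krausMap, LinearMap.coe_mk, AddHom.coe_mk, Finset.sum_mul, opTrace_sum]
  refine Finset.sum_congr rfl fun i _ => ?_
  rw [opTrace_comp_comm, ContinuousLinearMap.comp_assoc, opTrace_comp_comm]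
  rfl

lemma isCPTP_krausMap {ι : Type*} [Fintype ι] {A : ι → H →L[ℂ] K}
    (hA : ∑ i, ContinuousLinearMap.adjoint (A i) ∘L A i = 1) : IsCPTP (krausMap A) :=
  ⟨isCP_krausMap A, fun χ => by rw [opTrace_krausMap, hA, one_mul]⟩

lemma krausMap_proj {ι : Type*} [Fintype ι] (A : ι → H →L[ℂ] K) (x : H) :
    krausMap A (proj x) = ∑ i, proj (A i x) := by
  simp only [krausMap, LinearMap.coe_mk, AddHom.coe_mk, proj]
  refine Finset.sum_congr rfl fun i _ => ?_
  rw [InnerProductSpace.rankOne_comp, InnerProductSpace.comp_rankOne,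
    ContinuousLinearMap.adjoint_adjoint]

lemma IsCPTP.comp {Λ : (H →L[ℂ] H) →ₗ[ℂ] (K →L[ℂ] K)} {Λ' : (K →L[ℂ] K) →ₗ[ℂ] (L →L[ℂ] L)}
    (h' : IsCPTP Λ') (h : IsCPTP Λ) : IsCPTP (Λ' ∘ₗ Λ) :=
  ⟨IsCP.comp h'.1 h.1, fun χ => by rw [LinearMap.comp_apply, h'.2, h.2]⟩

lemma IsCPTP.isState {Λ : (H →L[ℂ] H) →ₗ[ℂ] (K →L[ℂ] K)} (h : IsCPTP Λ) {ρ : H →L[ℂ] H}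
    (hρ : IsState ρ) : IsState (Λ ρ) :=
  ⟨IsCP.nonneg h.1 hρ.1, by rw [h.2, hρ.2]⟩

/-- The trace distance is contractive under completely positive trace preserving maps. -/
lemma IsCPTP.traceDist_le {Λ : (H →L[ℂ] H) →ₗ[ℂ] (K →L[ℂ] K)} (h : IsCPTP Λ) {ρ σ : H →L[ℂ] H}
    (hρ : 0 ≤ ρ) (hσ : 0 ≤ σ) : traceDist (Λ ρ) (Λ σ) ≤ traceDist ρ σ := by
  have hX : IsSelfAdjoint (ρ - σ) := (IsSelfAdjoint.of_nonneg hρ).sub (IsSelfAdjoint.of_nonneg hσ)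
  -- Split `ρ - σ` into positive and negative parts. Their images are positive with the same traces,
  -- and these traces add up to the trace norm of `ρ - σ`.
  have h1 := re_opTrace_sqrt_le (Y := Λ ρ - Λ σ) (IsCP.nonneg h.1 (CFC.posPart_nonneg (ρ - σ)))
    (IsCP.nonneg h.1 (CFC.negPart_nonneg (ρ - σ))) (by
      rw [← map_sub, ← map_sub, CFC.posPart_sub_negPart (ρ - σ) hX])
  rw [h.2, h.2, ← Complex.add_re, ← opTrace_add, CFC.posPart_add_negPart (ρ - σ) hX, CFC.abs,
    hX.star_eq] at h1
  rw [traceDist, traceDist, hX.star_eq]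
  linarith

/-- If `Λ ρ` is pure, then `Λ` maps every pure state occurring in `ρ` to `Λ ρ`. -/
lemma apply_eq_of_mem_ensemblePure {Λ : (H →L[ℂ] H) →ₗ[ℂ] (K →L[ℂ] K)} (h : IsCPTP Λ)
    {ρ P : H →L[ℂ] H} (hρ : ρ ∈ Pur Λ) (hP : P ∈ ensemblePure ρ) : Λ ρ = Λ P := by
  obtain ⟨φ, hφ, rfl, p, hp, hle⟩ := hP
  refine eq_of_smul_le (h.isState hρ.1) hρ.2 (h.isState ⟨proj_nonneg φ, ?_⟩) hp ?_
  · simp [opTrace_proj, hφ]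
  · rw [← map_smul, ← map_sub]
    exact IsCP.nonneg h.1 hle

lemma opTrace_proj_sq {φ : H} (hφ : ‖φ‖ = 1) : opTrace (proj φ ^ 2) = 1 := by
  rw [pow_two, opTrace_mul_proj, proj_apply]
  simp [inner_self_eq_norm_sq_to_K, hφ]

lemma adjoint_tensorLeft_tmul (x h : H) (y : K) :
    ContinuousLinearMap.adjoint (tensorLeft (K := K) x) (h ⊗ₜ[ℂ] y) = ⟪x, h⟫_ℂ • y := by
  refine ext_inner_left ℂ fun z : K => ?_
  rw [ContinuousLinearMap.adjoint_inner_right, inner_smul_right]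
  simp [tensorLeft]

lemma isCPTP_partialTrace : IsCPTP (partialTrace (H := H) (K := K)) := by
  refine isCPTP_krausMap ?_
  refine ContinuousLinearMap.coe_injective (TensorProduct.ext' fun h y => ?_)
  simp only [ContinuousLinearMap.adjoint_adjoint, ContinuousLinearMap.coe_coe, sum_apply,
    ContinuousLinearMap.comp_apply, adjoint_tensorLeft_tmul, map_smul]
  have : ∀ k, tensorLeft (stdOrthonormalBasis ℂ H k) y = stdOrthonormalBasis ℂ H k ⊗ₜ[ℂ] y :=
    fun k => rfl
  simp only [this, TensorProduct.smul_tmul', ← TensorProduct.sum_tmul,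
    OrthonormalBasis.sum_repr']
  rfl

lemma partialTrace_proj_tmul {x : H} (hx : ‖x‖ = 1) (y : K) :
    partialTrace (proj (x ⊗ₜ[ℂ] y)) = proj y := by
  rw [partialTrace, krausMap_proj]
  ext z
  simp only [adjoint_tensorLeft_tmul, sum_apply, proj_apply, inner_smul_left, smul_smul]
  rw [← Finset.sum_smul]
  congr 1
  have := (stdOrthonormalBasis ℂ H).sum_inner_mul_inner x x
  rw [inner_self_eq_norm_sq_to_K, hx] at this
  simp only [inner_conj_symm, mul_right_comm _ ⟪y, z⟫_ℂ, ← Finset.sum_mul, this]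
  simp

end Maps

/-! ### Pure states below a state and its support. -/

section Ensemble

variable {H : Type*} [NormedAddCommGroup H] [InnerProductSpace ℂ H] [CompleteSpace H]
  [FiniteDimensional ℂ H]

lemma mem_supp_iff {ρ : H →L[ℂ] H} (hρ : 0 ≤ ρ) (φ : H) : φ ∈ supp ρ ↔ ∃ χ, ρ χ = φ := by
  have hsym : (ρ : H →ₗ[ℂ] H).IsSymmetric := (IsSelfAdjoint.of_nonneg hρ).isSymmetric
  rw [supp, ← hsym.orthogonal_range, Submodule.orthogonal_orthogonal]
  rfl

/-- The pure states occurring in ensembles represented by `ρ` are those in the support of `ρ`. -/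
lemma mem_ensemblePure_iff {ρ : H →L[ℂ] H} (hρ : 0 ≤ ρ) (P : H →L[ℂ] H) :
    P ∈ ensemblePure ρ ↔ ∃ φ ∈ supp ρ, ‖φ‖ = 1 ∧ P = proj φ := by
  constructor
  · rintro ⟨φ, hφ, rfl, p, hp, hle⟩
    refine ⟨φ, (Submodule.mem_orthogonal _ _).2 fun x hx => ?_, hφ, rfl⟩
    -- For `x` in the kernel of `ρ` the quadratic form equals `-p |⟨x, φ⟩|²`, so positivity forces
    -- `x ⟂ φ`.
    have h := re_inner_nonneg hle x
    have hx' : ρ x = 0 := hx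
    rw [sub_apply, hx', zero_sub, smul_apply, proj_apply, inner_neg_right, inner_smul_right,
      inner_smul_right, ← inner_conj_symm φ x, Complex.conj_mul', Complex.neg_re,
      ← Complex.ofReal_pow, ← Complex.ofReal_mul, Complex.ofReal_re] at h
    have h2 : ‖⟪x, φ⟫_ℂ‖ ^ 2 ≤ 0 := by
      by_contra hcon
      push Not at hcon
      nlinarith [mul_pos hp hcon]
    simpa using le_antisymm h2 (sq_nonneg _)
  · rintro ⟨φ, hφ, hn, rfl⟩
    obtain ⟨χ, rfl⟩ := (mem_supp_iff hρ φ).1 hφ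
    obtain ⟨S, hS⟩ := CStarAlgebra.nonneg_iff_eq_star_mul_self.1 hρ
    have hin : ∀ x y, ⟪x, ρ y⟫_ℂ = ⟪S x, S y⟫_ℂ := fun x y => by
      rw [hS, ContinuousLinearMap.star_eq_adjoint, mul_apply_eq_comp,
        ContinuousLinearMap.adjoint_inner_right]
    -- With `ρ = S†S`, Cauchy-Schwarz gives `|⟨x, ρ χ⟩|² ≤ ‖S x‖² ‖S χ‖²`, so any `p ≤ ‖S χ‖⁻²`
    -- works. The `+ 1` keeps the denominator positive without showing `S χ ≠ 0`.
    refine ⟨ρ χ, hn, rfl, (‖S χ‖ ^ 2 + 1)⁻¹, by positivity, ?_⟩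
    have hsa : IsSelfAdjoint (ρ - (((‖S χ‖ ^ 2 + 1)⁻¹ : ℝ) : ℂ) • proj (ρ χ)) :=
      (IsSelfAdjoint.of_nonneg hρ).sub
        (IsSelfAdjoint.of_nonneg (ofReal_smul_nonneg (by positivity) (proj_nonneg _)))
    refine (ContinuousLinearMap.nonneg_iff_isPositive _).2
      (ContinuousLinearMap.isPositive_def.2 ⟨hsa.isSymmetric, fun x => ?_⟩)
    have e : ⟪(ρ - (((‖S χ‖ ^ 2 + 1)⁻¹ : ℝ) : ℂ) • proj (ρ χ)) x, x⟫_ℂ =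
        ((‖S x‖ ^ 2 - (‖S χ‖ ^ 2 + 1)⁻¹ * ‖⟪S x, S χ⟫_ℂ‖ ^ 2 : ℝ) : ℂ) := by
      have h1 : ⟪ρ χ, x⟫_ℂ = starRingEnd ℂ ⟪S x, S χ⟫_ℂ := by rw [← hin, inner_conj_symm]
      have h2 : ⟪ρ x, x⟫_ℂ = (‖S x‖ : ℂ) ^ 2 := by
        rw [← inner_conj_symm, hin, inner_self_eq_norm_sq_to_K]
        simp
      rw [sub_apply, inner_sub_left, smul_apply, proj_apply, inner_smul_left, inner_smul_left, h2,
        h1, Complex.conj_ofReal, Complex.conj_conj, Complex.mul_conj']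
      push_cast
      ring
    rw [ContinuousLinearMap.reApplyInnerSelf_apply, e, RCLike.re_eq_complex_re, Complex.ofReal_re,
      sub_nonneg, inv_mul_le_iff₀ (by positivity)]
    have hcs := norm_inner_le_norm (𝕜 := ℂ) (S x) (S χ)
    calc ‖⟪S x, S χ⟫_ℂ‖ ^ 2 ≤ (‖S x‖ * ‖S χ‖) ^ 2 := by gcongr
      _ ≤ _ := by nlinarith [sq_nonneg ‖S x‖]

lemma finrank_supp_pos {ρ : H →L[ℂ] H} (hρ : IsState ρ) : 0 < finrank ℂ (supp ρ) := by
  rw [Nat.pos_iff_ne_zero, Ne, Submodule.finrank_eq_zero, supp, Submodule.orthogonal_eq_bot_iff]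
  intro h
  have h0 : (ρ : H →ₗ[ℂ] H) = 0 := LinearMap.ker_eq_top.1 h
  have := hρ.2
  rw [opTrace, h0] at this
  simp at this

end Ensemble

/-! ### Existence of Jordan bases and the value of the worst-case distinguishability. -/

section Jordan

variable {H : Type*} [NormedAddCommGroup H] [InnerProductSpace ℂ H] [FiniteDimensional ℂ H]

/-- A singular value decomposition of the projection of a subspace to a larger one. -/
lemma exists_orthonormalBasis_inner_eq_ite (A B : Submodule ℂ H)
    (h : finrank ℂ B ≤ finrank ℂ A) :
    ∃ (b : OrthonormalBasis (Fin (finrank ℂ A)) ℂ A) (w : OrthonormalBasis (Fin (finrank ℂ B)) ℂ B)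
      (c : Fin (finrank ℂ B) → ℝ), (∀ l, 0 ≤ c l) ∧
        ∀ k l, ⟪(b k : H), (w l : H)⟫_ℂ = if (k : ℕ) = l then (c l : ℂ) else 0 := by
  have := FiniteDimensional.complete ℂ A
  have := FiniteDimensional.complete ℂ B
  set T : B →L[ℂ] A := A.orthogonalProjectionOnto ∘L B.subtypeL
  have hsa : ((ContinuousLinearMap.adjoint T ∘L T : B →L[ℂ] B) : B →ₗ[ℂ] B).IsSymmetric :=
    (ContinuousLinearMap.isPositive_adjoint_comp_self T).isSymmetric
  set w := hsa.eigenvectorBasis rfl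
  have horth : ∀ i j, i ≠ j → ⟪T (w i), T (w j)⟫_ℂ = 0 := fun i j hij => by
    rw [← ContinuousLinearMap.adjoint_inner_right]
    have := hsa.apply_eigenvectorBasis rfl j
    rw [ContinuousLinearMap.coe_coe, ContinuousLinearMap.comp_apply] at this
    rw [this, inner_smul_right, w.inner_eq_zero hij, mul_zero]
  -- These are the normalised left singular vectors. Indices with zero singular value or beyond
  -- `finrank ℂ B` get the dummy value `0`; only the nonzero vectors are completed to a basis of
  -- `A`.
  let f : Fin (finrank ℂ A) → A := fun k =>
    if hk : (k : ℕ) < finrank ℂ B then ((‖T (w ⟨k, hk⟩)‖⁻¹ : ℝ) : ℂ) • T (w ⟨k, hk⟩) else 0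
  have hf : Orthonormal ℂ (Set.domRestrict {k | f k ≠ 0} f) := by
    constructor
    · rintro ⟨k, hk⟩
      change f k ≠ 0 at hk
      change ‖f k‖ = 1
      simp only [f] at hk ⊢
      split_ifs at hk ⊢ with hk'
      · have hne : T (w ⟨k, hk'⟩) ≠ 0 := by
          intro h0
          simp [h0] at hk
        rw [norm_smul, Complex.norm_real, norm_inv, norm_norm,
          inv_mul_cancel₀ (norm_ne_zero_iff.2 hne)]
      · exact absurd rfl hk
    · rintro ⟨k, hk⟩ ⟨l, hl⟩ hkl
      have hkl' : (k : ℕ) ≠ l := fun h => hkl (Subtype.ext (Fin.ext h))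
      change ⟪f k, f l⟫_ℂ = 0
      simp only [f]
      split_ifs with h1 h2
      · rw [inner_smul_left, inner_smul_right, horth _ _ (fun h => hkl' (Fin.mk.inj_iff.1 h))]
        simp
      all_goals simp
  obtain ⟨b, hb⟩ := hf.exists_orthonormalBasis_extension_of_card_eq (by simp)
  refine ⟨b, w, fun l => ‖T (w l)‖, fun l => norm_nonneg _, fun k l => ?_⟩
  have h1 : ⟪(b k : H), (w l : H)⟫_ℂ = ⟪b k, T (w l)⟫_ℂ :=
    (Submodule.inner_orthogonalProjectionOnto_eq_of_mem_left (b k) (w l : H)).symm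
  rw [h1]
  by_cases h0 : T (w l) = 0
  · simp [h0]
  have hn : ‖T (w l)‖ ≠ 0 := norm_ne_zero_iff.2 h0
  have hfl : f (l.castLE h) = ((‖T (w l)‖⁻¹ : ℝ) : ℂ) • T (w l) := by
    simp [f]
  have hbl := hb (l.castLE h) (by
    rw [Set.mem_ofPred_eq, hfl]
    exact smul_ne_zero (by exact_mod_cast inv_ne_zero hn) h0)
  have h2 : T (w l) = (‖T (w l)‖ : ℂ) • b (l.castLE h) := by
    rw [hbl, hfl, smul_smul, ← Complex.ofReal_mul, mul_inv_cancel₀ hn, Complex.ofReal_one, one_smul]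
  have h3 : ⟪b k, T (w l)⟫_ℂ = ‖T (w l)‖ * if k = l.castLE h then 1 else 0 := by
    conv_lhs => rw [h2]
    rw [inner_smul_right, b.inner_eq_ite]
  rw [h3]
  by_cases hkl : (k : ℕ) = l
  · rw [if_pos hkl, if_pos (Fin.ext hkl), mul_one]
  · rw [if_neg hkl, if_neg (fun h => hkl (congrArg Fin.val h)), mul_zero]

/-- Every two subspaces have Jordan bases. -/
lemma nonempty_jordanBases (A B : Submodule ℂ H) : Nonempty (JordanBases A B) := by
  -- Indexing the singular values by `ℕ`, with zeros as padding, gives both orders of the dimensions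
  -- the same form.
  obtain ⟨b, w, c, hc0, hc⟩ : ∃ (b : OrthonormalBasis (Fin (finrank ℂ A)) ℂ A)
      (w : OrthonormalBasis (Fin (finrank ℂ B)) ℂ B) (c : ℕ → ℝ), (∀ l, 0 ≤ c l) ∧
        ∀ k l, ⟪(b k : H), (w l : H)⟫_ℂ = if (k : ℕ) = l then (c l : ℂ) else 0 := by
    rcases le_total (finrank ℂ B) (finrank ℂ A) with h | h
    · obtain ⟨b, w, c, hc0, hc⟩ := exists_orthonormalBasis_inner_eq_ite A B h
      refine ⟨b, w, fun l => if hl : l < finrank ℂ B then c ⟨l, hl⟩ else 0, fun l => ?_,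
        fun k l => ?_⟩
      · dsimp only
        split_ifs with hl
        exacts [hc0 _, le_rfl]
      · rw [hc]
        simp
    · obtain ⟨w, b, c, hc0, hc⟩ := exists_orthonormalBasis_inner_eq_ite B A h
      refine ⟨b, w, fun l => if hl : l < finrank ℂ A then c ⟨l, hl⟩ else 0, fun l => ?_,
        fun k l => ?_⟩
      · dsimp only
        split_ifs with hl
        exacts [hc0 _, le_rfl]
      · rw [← inner_conj_symm, hc]
        by_cases hkl : (k : ℕ) = l
        · rw [if_pos hkl.symm, if_pos hkl, ← hkl]
          simp
        · rw [if_neg (Ne.symm hkl), if_neg hkl, map_zero]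
  have hc1 : ∀ k : Fin (min (finrank ℂ A) (finrank ℂ B)), c k ≤ 1 := fun k => by
    have h := norm_inner_le_norm (𝕜 := ℂ) (b (k.castLE (min_le_left _ _)) : H)
      (w (k.castLE (min_le_right _ _)) : H)
    rw [hc, Submodule.norm_coe, Submodule.norm_coe, b.norm_eq_one, w.norm_eq_one] at h
    simpa [abs_of_nonneg (hc0 k)] using h
  exact ⟨{
    basis₁ := b
    basis₂ := w
    angle := fun k => Real.arccos (c k)
    angle_mem := fun k => ⟨Real.arccos_nonneg _, Real.arccos_le_pi_div_two.2 (hc0 _)⟩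
    inner_of_ne := fun k l hkl => by rw [hc, if_neg hkl]
    inner_eq := fun k => by
      rw [hc, Real.cos_arccos (by linarith [hc0 k]) (hc1 k)]
      simp }⟩

namespace JordanBases

variable {A₁ A₂ : Submodule ℂ H} (J : JordanBases A₁ A₂)

/-- Collapses the double sum in `⟨x, y⟩`: in Jordan bases the rectangular Gram matrix is diagonal.
-/
lemma sum_sum_eq_sum_castLE {M : Type*} [AddCommMonoid M] {m n : ℕ} (f : Fin m → Fin n → M)
    (hf : ∀ (k : Fin m) (l : Fin n), (k : ℕ) ≠ l → f k l = 0) :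
    ∑ k, ∑ l, f k l =
      ∑ j : Fin (min m n), f (j.castLE (min_le_left _ _)) (j.castLE (min_le_right _ _)) := by
  rw [← Fintype.sum_prod_type']
  refine (Fintype.sum_of_injective (fun j : Fin (min m n) =>
    (j.castLE (min_le_left _ _), j.castLE (min_le_right _ _))) ?_ _ _ ?_ fun _ => rfl).symm
  · intro i j h
    exact Fin.castLE_injective (min_le_left m n) (Prod.ext_iff.1 h).1
  · rintro ⟨k, l⟩ h
    refine hf k l fun hkl => h ⟨⟨k, lt_min k.2 (hkl ▸ l.2)⟩, ?_⟩
    exact Prod.ext (Fin.ext rfl) (Fin.ext hkl)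

lemma sum_castLE_le {m n : ℕ} (h : m ≤ n) (f : Fin n → ℝ) (hf : ∀ i, 0 ≤ f i) :
    ∑ j : Fin m, f (j.castLE h) ≤ ∑ i, f i := by
  rw [show ∑ j, f (Fin.castLE h j) = _ from (Finset.sum_map Finset.univ (Fin.castLEEmb h) f).symm]
  exact Finset.sum_le_univ_sum_of_nonneg hf

lemma cos_angle_nonneg (k) : 0 ≤ Real.cos (J.angle k) :=
  Real.cos_nonneg_of_mem_Icc ⟨by linarith [(J.angle_mem k).1, Real.pi_pos], (J.angle_mem k).2⟩

lemma sin_angle_nonneg (k) : 0 ≤ Real.sin (J.angle k) :=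
  Real.sin_nonneg_of_mem_Icc ⟨(J.angle_mem k).1, by linarith [(J.angle_mem k).2, Real.pi_pos]⟩

/-- The inner product of unit vectors is bounded by the largest cosine of a Jordan angle. -/
lemma norm_inner_le {c : ℝ} (hc : ∀ k, Real.cos (J.angle k) ≤ c) (hc0 : 0 ≤ c) {x y : H}
    (hx : x ∈ A₁) (hy : y ∈ A₂) (hx1 : ‖x‖ = 1) (hy1 : ‖y‖ = 1) : ‖⟪x, y⟫_ℂ‖ ≤ c := by
  set a := J.basis₁.repr ⟨x, hx⟩
  set b := J.basis₂.repr ⟨y, hy⟩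
  have ex : x = ∑ k, a k • (J.basis₁ k : H) := by
    simpa using (congrArg Subtype.val (J.basis₁.sum_repr ⟨x, hx⟩)).symm
  have ey : y = ∑ l, b l • (J.basis₂ l : H) := by
    simpa using (congrArg Subtype.val (J.basis₂.sum_repr ⟨y, hy⟩)).symm
  have ha : ∑ k, ‖a k‖ ^ 2 = 1 := by
    rw [← EuclideanSpace.norm_sq_eq, LinearIsometryEquiv.norm_map]
    simp [hx1]
  have hb : ∑ k, ‖b k‖ ^ 2 = 1 := by
    rw [← EuclideanSpace.norm_sq_eq, LinearIsometryEquiv.norm_map]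
    simp [hy1]
  have key : ⟪x, y⟫_ℂ = ∑ j, starRingEnd ℂ (a (j.castLE (min_le_left _ _))) *
      (b (j.castLE (min_le_right _ _)) * Real.cos (J.angle j)) := by
    rw [ex, ey, sum_inner]
    simp only [inner_sum, inner_smul_left, inner_smul_right]
    rw [sum_sum_eq_sum_castLE]
    · simp only [J.inner_eq, mul_left_comm]
    · intro k l hkl
      rw [J.inner_of_ne k l hkl, mul_zero, mul_zero]
  calc ‖⟪x, y⟫_ℂ‖ ≤ ∑ j : Fin (min (finrank ℂ A₁) (finrank ℂ A₂)),
      c / 2 * (‖a (j.castLE (min_le_left _ _))‖ ^ 2 + ‖b (j.castLE (min_le_right _ _))‖ ^ 2) := by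
        rw [key]
        refine norm_sum_le_of_le _ fun j _ => ?_
        rw [norm_mul, norm_mul, RCLike.norm_conj, Complex.norm_real,
          Real.norm_of_nonneg (J.cos_angle_nonneg j)]
        set s := ‖a (j.castLE (min_le_left _ _))‖
        set t := ‖b (j.castLE (min_le_right _ _))‖
        have hst : 0 ≤ s * t := by positivity
        -- The bound used is `s t ≤ (s² + t²) / 2`, after replacing the cosine by `c`.
        nlinarith [mul_le_mul_of_nonneg_left (hc j) hst, mul_nonneg hc0 (sq_nonneg (s - t))]
    _ = c / 2 * (∑ j : Fin (min (finrank ℂ A₁) (finrank ℂ A₂)),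
          ‖a (j.castLE (min_le_left _ _))‖ ^ 2 + ∑ j : Fin (min (finrank ℂ A₁) (finrank ℂ A₂)),
          ‖b (j.castLE (min_le_right _ _))‖ ^ 2) := by
        rw [← Finset.sum_add_distrib, Finset.mul_sum]
    _ ≤ c / 2 * (1 + 1) := by
        refine mul_le_mul_of_nonneg_left (add_le_add ?_ ?_) (by positivity)
        · exact ha ▸ sum_castLE_le (min_le_left _ _) (fun k => ‖a k‖ ^ 2) fun _ => sq_nonneg _
        · exact hb ▸ sum_castLE_le (min_le_right _ _) (fun k => ‖b k‖ ^ 2) fun _ => sq_nonneg _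
    _ = c := by ring

lemma norm_ψ₁ (k) : ‖J.ψ₁ k‖ = 1 := by
  rw [ψ₁, Submodule.norm_coe, J.basis₁.norm_eq_one]

lemma norm_ψ₂ (k) : ‖J.ψ₂ k‖ = 1 := by
  rw [ψ₂, Submodule.norm_coe, J.basis₂.norm_eq_one]

variable [CompleteSpace H]

/-- The smallest sine of a Jordan angle of the supports is the worst-case distinguishability. -/
lemma isLeast_wcd {ρ₁ ρ₂ : H →L[ℂ] H} (h₁ : IsState ρ₁) (h₂ : IsState ρ₂)
    (J : JordanBases (supp ρ₁) (supp ρ₂)) :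
    IsLeast (Set.range fun k => Real.sin (J.angle k)) (wcd ρ₁ ρ₂) := by
  have : Nonempty (Fin (min (finrank ℂ (supp ρ₁)) (finrank ℂ (supp ρ₂)))) :=
    ⟨⟨0, lt_min (finrank_supp_pos h₁) (finrank_supp_pos h₂)⟩⟩
  obtain ⟨k₀, hk₀⟩ := Finite.exists_min fun k => Real.sin (J.angle k)
  -- The smallest sine belongs to the largest cosine, because both functions are nonnegative on the
  -- Jordan angles.
  have hcos : ∀ k, Real.cos (J.angle k) ≤ Real.cos (J.angle k₀) := fun k => by
    refine abs_le_of_sq_le_sq' ?_ (J.cos_angle_nonneg k₀) |>.2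
    rw [Real.cos_sq', Real.cos_sq']
    have := pow_le_pow_left₀ (J.sin_angle_nonneg k₀) (hk₀ k) 2
    linarith
  have hleast : IsLeast {t | ∃ P₁ ∈ ensemblePure ρ₁, ∃ P₂ ∈ ensemblePure ρ₂, t = traceDist P₁ P₂}
      (Real.sin (J.angle k₀)) := by
    constructor
    · refine ⟨proj (J.ψ₁ k₀), (mem_ensemblePure_iff h₁.1 _).2
        ⟨_, Submodule.coe_mem _, J.norm_ψ₁ k₀, rfl⟩, proj (J.ψ₂ k₀),
        (mem_ensemblePure_iff h₂.1 _).2 ⟨_, Submodule.coe_mem _, J.norm_ψ₂ k₀, rfl⟩, ?_⟩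
      rw [traceDist_proj (J.norm_ψ₁ k₀) (J.norm_ψ₂ k₀), ψ₁, ψ₂, J.inner_eq, Complex.norm_real,
        Real.norm_eq_abs, sq_abs, ← Real.sin_sq, Real.sqrt_sq (J.sin_angle_nonneg k₀)]
    · rintro t ⟨P₁, hP₁, P₂, hP₂, rfl⟩
      obtain ⟨x, hx, hx1, rfl⟩ := (mem_ensemblePure_iff h₁.1 _).1 hP₁
      obtain ⟨y, hy, hy1, rfl⟩ := (mem_ensemblePure_iff h₂.1 _).1 hP₂
      rw [traceDist_proj hx1 hy1]
      refine Real.le_sqrt_of_sq_le ?_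
      rw [Real.sin_sq]
      have := pow_le_pow_left₀ (norm_nonneg _)
        (J.norm_inner_le hcos (J.cos_angle_nonneg k₀) hx hy hx1 hy1) 2
      linarith
  have hw : wcd ρ₁ ρ₂ = Real.sin (J.angle k₀) := hleast.csInf_eq
  rw [hw]
  exact ⟨⟨k₀, rfl⟩, by rintro _ ⟨k, rfl⟩; exact hk₀ k⟩

end JordanBases

end Jordan

/-! ### The upper bound for purifying maps. -/

section UpperBound

variable {H : Type*} [NormedAddCommGroup H] [InnerProductSpace ℂ H] [CompleteSpace H]
  [FiniteDimensional ℂ H]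
  {K : Type*} [NormedAddCommGroup K] [InnerProductSpace ℂ K] [CompleteSpace K]
  [FiniteDimensional ℂ K]

lemma ensemblePure_nonempty {ρ : H →L[ℂ] H} (hρ : IsState ρ) : (ensemblePure ρ).Nonempty := by
  have := finrank_pos_iff.1 (finrank_supp_pos hρ)
  obtain ⟨x, hx⟩ := exists_norm_eq (supp ρ) zero_le_one
  exact ⟨proj (x : H), (mem_ensemblePure_iff hρ.1 _).2 ⟨x, x.2, hx, rfl⟩⟩

/-- Purifying maps cannot beat the worst-case distinguishability. -/
lemma traceDist_le_wcd {ρ₁ ρ₂ : H →L[ℂ] H} {Λ : (H →L[ℂ] H) →ₗ[ℂ] (K →L[ℂ] K)} (hΛ : IsCPTP Λ)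
    (h : {ρ₁, ρ₂} ⊆ Pur Λ) : traceDist (Λ ρ₁) (Λ ρ₂) ≤ wcd ρ₁ ρ₂ := by
  have h₁ : ρ₁ ∈ Pur Λ := h (by simp)
  have h₂ : ρ₂ ∈ Pur Λ := h (by simp)
  obtain ⟨P, hP⟩ := ensemblePure_nonempty h₁.1
  obtain ⟨Q, hQ⟩ := ensemblePure_nonempty h₂.1
  refine le_csInf ⟨_, P, hP, Q, hQ, rfl⟩ ?_
  rintro t ⟨P₁, hP₁, P₂, hP₂, rfl⟩
  rw [apply_eq_of_mem_ensemblePure hΛ h₁ hP₁, apply_eq_of_mem_ensemblePure hΛ h₂ hP₂]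
  obtain ⟨φ₁, -, rfl, -⟩ := hP₁
  obtain ⟨φ₂, -, rfl, -⟩ := hP₂
  exact hΛ.traceDist_le (proj_nonneg _) (proj_nonneg _)

end UpperBound

/-! ### Geometry of the Jordan vectors and the angle-shrinking map. -/

namespace JordanBases

section Vectors

variable {H : Type*} [NormedAddCommGroup H] [InnerProductSpace ℂ H] [FiniteDimensional ℂ H]
  {A₁ A₂ : Submodule ℂ H} (J : JordanBases A₁ A₂)

lemma ψ₁_mem (k) : J.ψ₁ k ∈ A₁ := Submodule.coe_mem _

lemma ψ₂_mem (k) : J.ψ₂ k ∈ A₂ := Submodule.coe_mem _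

lemma inner_ψ₁_ψ₁ (j k) : ⟪J.ψ₁ j, J.ψ₁ k⟫_ℂ = if j = k then 1 else 0 := by
  rw [ψ₁, ψ₁, ← Submodule.coe_inner, J.basis₁.inner_eq_ite]
  simp [Fin.ext_iff]

lemma inner_ψ₂_ψ₂ (j k) : ⟪J.ψ₂ j, J.ψ₂ k⟫_ℂ = if j = k then 1 else 0 := by
  rw [ψ₂, ψ₂, ← Submodule.coe_inner, J.basis₂.inner_eq_ite]
  simp [Fin.ext_iff]

lemma eq_of_inner_basis {A : Submodule ℂ H} {n : ℕ} (b : OrthonormalBasis (Fin n) ℂ A) {u w : H}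
    (h : ∀ i, ⟪u, (b i : H)⟫_ℂ = ⟪w, (b i : H)⟫_ℂ) {x : H} (hx : x ∈ A) : ⟪u, x⟫_ℂ = ⟪w, x⟫_ℂ := by
  have ex : x = ∑ k, b.repr ⟨x, hx⟩ k • (b k : H) := by
    simpa using (congrArg Subtype.val (b.sum_repr ⟨x, hx⟩)).symm
  rw [ex]
  simp only [inner_sum, inner_smul_right, h]

/-- The orthogonal projection of `ψ₂ k` to `A₁` is `cos ϑ_k ψ₁ k`, as can be tested on `basis₁`. -/
lemma inner_ψ₂_of_mem (k) {x : H} (hx : x ∈ A₁) :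
    ⟪J.ψ₂ k, x⟫_ℂ = Real.cos (J.angle k) * ⟪J.ψ₁ k, x⟫_ℂ := by
  have h := eq_of_inner_basis J.basis₁ (u := J.ψ₂ k) (w := (Real.cos (J.angle k) : ℂ) • J.ψ₁ k)
    (fun i => ?_) hx
  · rw [h, inner_smul_left, Complex.conj_ofReal]
  rw [inner_smul_left, Complex.conj_ofReal, ψ₁, ← Submodule.coe_inner, J.basis₁.inner_eq_ite,
    ← inner_conj_symm]
  by_cases hi : (i : ℕ) = k
  · obtain rfl : i = k.castLE (min_le_left _ _) := Fin.ext hi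
    rw [if_pos rfl, ψ₂, J.inner_eq, Complex.conj_ofReal, mul_one]
  · rw [if_neg (fun h => hi (congrArg Fin.val h).symm), ψ₂, J.inner_of_ne i _ hi]
    simp

lemma inner_ψ₁_of_mem (k) {y : H} (hy : y ∈ A₂) :
    ⟪J.ψ₁ k, y⟫_ℂ = Real.cos (J.angle k) * ⟪J.ψ₂ k, y⟫_ℂ := by
  have h := eq_of_inner_basis J.basis₂ (u := J.ψ₁ k) (w := (Real.cos (J.angle k) : ℂ) • J.ψ₂ k)
    (fun i => ?_) hy
  · rw [h, inner_smul_left, Complex.conj_ofReal]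
  rw [inner_smul_left, Complex.conj_ofReal, ψ₂, ← Submodule.coe_inner, J.basis₂.inner_eq_ite]
  by_cases hi : (k : ℕ) = i
  · obtain rfl : k.castLE (min_le_right _ _) = i := Fin.ext hi
    rw [if_pos rfl, ψ₁, J.inner_eq, mul_one]
  · rw [if_neg (fun h => hi (congrArg Fin.val h)), ψ₁, J.inner_of_ne _ i hi]
    simp

lemma inner_ψPerp_of_mem_left (k) {x : H} (hx : x ∈ A₁) : ⟪J.ψPerp k, x⟫_ℂ = 0 := by
  rw [ψPerp, inner_smul_left, inner_sub_left, inner_smul_left, Complex.conj_ofReal,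
    Complex.conj_ofReal, J.inner_ψ₂_of_mem k hx, sub_self, mul_zero]

lemma inner_ψPerp_of_mem_right (k) {y : H} (hy : y ∈ A₂) :
    ⟪J.ψPerp k, y⟫_ℂ = Real.sin (J.angle k) * ⟪J.ψ₂ k, y⟫_ℂ := by
  rw [ψPerp, inner_smul_left, inner_sub_left, inner_smul_left, Complex.conj_ofReal,
    Complex.conj_ofReal, J.inner_ψ₁_of_mem k hy]
  have h : (Real.sin (J.angle k))⁻¹ * (1 - Real.cos (J.angle k) * Real.cos (J.angle k)) =
      Real.sin (J.angle k) := by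
    rw [← pow_two, ← Real.sin_sq]
    rcases eq_or_ne (Real.sin (J.angle k)) 0 with h | h
    · simp [h]
    · field_simp
  have h' : (((Real.sin (J.angle k))⁻¹ : ℝ) : ℂ) *
      (1 - Real.cos (J.angle k) * Real.cos (J.angle k)) = Real.sin (J.angle k) := by
    exact_mod_cast h
  linear_combination ⟪J.ψ₂ k, y⟫_ℂ * h'

lemma inner_ψPerp_ψ₁ (j k) : ⟪J.ψPerp j, J.ψ₁ k⟫_ℂ = 0 :=
  J.inner_ψPerp_of_mem_left j (J.ψ₁_mem k)

lemma inner_ψ₁_ψPerp (j k) : ⟪J.ψ₁ j, J.ψPerp k⟫_ℂ = 0 :=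
  inner_eq_zero_symm.1 (J.inner_ψPerp_ψ₁ k j)

lemma inner_ψPerp_ψPerp_eq (j k) : ⟪J.ψPerp j, J.ψPerp k⟫_ℂ =
    if j = k then if Real.sin (J.angle k) = 0 then 0 else 1 else 0 := by
  have h : ⟪J.ψPerp j, J.ψPerp k⟫_ℂ =
      ((Real.sin (J.angle k))⁻¹ * Real.sin (J.angle j) : ℝ) * ⟪J.ψ₂ j, J.ψ₂ k⟫_ℂ := by
    change ⟪J.ψPerp j, (((Real.sin (J.angle k))⁻¹ : ℝ) : ℂ) •
      (J.ψ₂ k - (Real.cos (J.angle k) : ℂ) • J.ψ₁ k)⟫_ℂ = _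
    rw [inner_smul_right, inner_sub_right, inner_smul_right,
      J.inner_ψPerp_ψ₁, J.inner_ψPerp_of_mem_right j (J.ψ₂_mem k)]
    push_cast
    ring
  rw [h, inner_ψ₂_ψ₂]
  split_ifs with h1 h2
  · simp [h2]
  · subst h1
    simp [inv_mul_cancel₀ h2]
  · simp

lemma ψPerp_eq_zero_or (k) : (J.ψPerp k = 0 ∧ Real.sin (J.angle k) = 0) ∨
    ⟪J.ψPerp k, J.ψPerp k⟫_ℂ = 1 := by
  have h := J.inner_ψPerp_ψPerp_eq k k
  rw [if_pos rfl] at h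
  split_ifs at h with h1
  · exact .inl ⟨inner_self_eq_zero.1 h, h1⟩
  · exact .inr h

/-- This form lets `proj (ψPerp k)` fix `ψPerp k` also in the degenerate case `ψPerp k = 0`. -/
lemma inner_ψPerp_ψPerp_smul (j k) : ⟪J.ψPerp j, J.ψPerp k⟫_ℂ • J.ψPerp j =
    if j = k then J.ψPerp k else 0 := by
  by_cases h : j = k
  · subst h
    rw [if_pos rfl]
    rcases J.ψPerp_eq_zero_or j with h | h
    · simp [h.1]
    · rw [h, one_smul]
  · rw [inner_ψPerp_ψPerp_eq, if_neg h, if_neg h, zero_smul]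

lemma ψ₂_eq (k) : J.ψ₂ k = (Real.cos (J.angle k) : ℂ) • J.ψ₁ k +
    (Real.sin (J.angle k) : ℂ) • J.ψPerp k := by
  rcases J.ψPerp_eq_zero_or k with ⟨h, hs⟩ | h
  -- If the sine vanishes, then `‖ψ₂ - cos ϑ ψ₁‖² = 1 - cos² ϑ = 0`.
  · rw [hs, Complex.ofReal_zero, zero_smul, add_zero, ← sub_eq_zero, ← inner_self_eq_zero (𝕜 := ℂ)]
    simp only [inner_sub_left, inner_sub_right, inner_smul_left, inner_smul_right,
      Complex.conj_ofReal, inner_ψ₁_ψ₁, inner_ψ₂_ψ₂, J.inner_ψ₂_of_mem k (J.ψ₁_mem k),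
      J.inner_ψ₁_of_mem k (J.ψ₂_mem k), if_true, mul_one]
    have := Real.sin_sq_add_cos_sq (J.angle k)
    rw [hs] at this
    have h2 : (Real.cos (J.angle k) : ℂ) * Real.cos (J.angle k) = 1 := by
      rw [← Complex.ofReal_mul]
      exact_mod_cast (by nlinarith : Real.cos (J.angle k) * Real.cos (J.angle k) = 1)
    rw [h2]
    ring
  · have hs : Real.sin (J.angle k) ≠ 0 := by
      intro hs
      rw [inner_ψPerp_ψPerp_eq, if_pos rfl, if_pos hs] at h
      exact zero_ne_one h
    rw [ψPerp, smul_smul, ← Complex.ofReal_mul, mul_inv_cancel₀ hs]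
    simp

end Vectors

/-- The trigonometric identities behind the reduction of an angle `θ` to `φ`. -/
lemma exists_shrink_coeff {φ θ a b : ℝ} (h0 : 0 ≤ φ) (hle : φ ≤ θ) (hθ : θ ≤ Real.pi / 2)
    (ha : a = if φ = θ then 1 else Real.tan φ * Real.cot θ)
    (hb : b = if φ = θ then 1 else Real.sin φ / Real.sin θ) :
    0 ≤ 1 - b ^ 2 ∧ 0 ≤ b ^ 2 - a ^ 2 ∧ ∃ α β : ℝ,
      Real.cos θ = α * Real.cos φ ∧ a * Real.sin θ = α * Real.sin φ ∧
      √(1 - b ^ 2) * Real.sin θ = β * Real.cos φ ∧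
      √(b ^ 2 - a ^ 2) * Real.sin θ = β * Real.sin φ := by
  rcases eq_or_lt_of_le hle with h | h
  · subst h
    rw [if_pos rfl] at ha hb
    subst ha hb
    exact ⟨by norm_num, by norm_num, 1, 0, by simp⟩
  rw [if_neg h.ne] at ha hb
  have hc : 0 < Real.cos φ := Real.cos_pos_of_mem_Ioo ⟨by linarith [Real.pi_pos], by linarith⟩
  have hs : 0 < Real.sin θ := Real.sin_pos_of_pos_of_lt_pi (by linarith) (by linarith [Real.pi_pos])
  have hs' : 0 ≤ Real.sin φ := Real.sin_nonneg_of_nonneg_of_le_pi h0 (by linarith [Real.pi_pos])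
  have hcθ : 0 ≤ Real.cos θ := Real.cos_nonneg_of_mem_Icc ⟨by linarith [Real.pi_pos], hθ⟩
  have hcc : Real.cos θ ≤ Real.cos φ :=
    Real.cos_le_cos_of_nonneg_of_le_pi h0 (by linarith [Real.pi_pos]) hle
  have hD : 0 ≤ Real.cos φ ^ 2 - Real.cos θ ^ 2 := by nlinarith
  -- Both roots are rational in `D`: `√(1 - b²) = D / sin θ` and `√(b² - a²) = sin φ D / (cos φ sin
  -- θ)`. This gives `α = cos θ / cos φ` and `β = D / cos φ`, the weights with which the two Kraus
  -- operators produce the rotated vector.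
  set D := √(Real.cos φ ^ 2 - Real.cos θ ^ 2)
  have hD0 : 0 ≤ D := Real.sqrt_nonneg _
  have hD2 : D ^ 2 = Real.cos φ ^ 2 - Real.cos θ ^ 2 := Real.sq_sqrt hD
  rw [Real.tan_eq_sin_div_cos, Real.cot_eq_cos_div_sin] at ha
  have e1 : 1 - b ^ 2 = (D / Real.sin θ) ^ 2 := by
    rw [hb, div_pow, div_pow, hD2, Real.sin_sq φ]
    field_simp
    rw [Real.sin_sq]
    ring
  have e2 : b ^ 2 - a ^ 2 = (Real.sin φ * D / (Real.cos φ * Real.sin θ)) ^ 2 := by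
    rw [hb, ha, div_pow (Real.sin φ * D), mul_pow (Real.sin φ) D, hD2]
    field_simp
  refine ⟨e1 ▸ sq_nonneg _, e2 ▸ sq_nonneg _, Real.cos θ / Real.cos φ, D / Real.cos φ, ?_, ?_, ?_,
    ?_⟩
  · field_simp
  · rw [ha]
    field_simp
  · rw [e1, Real.sqrt_sq (by positivity)]
    field_simp
  · rw [e2, Real.sqrt_sq (by positivity)]
    field_simp

section Shrink

variable {H : Type*} [NormedAddCommGroup H] [InnerProductSpace ℂ H] [FiniteDimensional ℂ H]
  [CompleteSpace H] {A₁ A₂ : Submodule ℂ H} (J : JordanBases A₁ A₂) {φ : ℝ}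

/-- On `ψPerp` the weights add up to `a² + (1 - b²) + (b² - a²) = 1`, so the pair acts isometrically
on each Jordan plane. -/
lemma star_mul_kraus (h0 : 0 ≤ φ) (hφ : ∀ k, φ ≤ J.angle k) (k) :
    star (J.kraus₁ φ k) * J.kraus₁ φ k + star (J.kraus₂ φ k) * J.kraus₂ φ k =
      proj (J.ψ₁ k) + proj (J.ψPerp k) := by
  obtain ⟨hb, ha, -⟩ := exists_shrink_coeff h0 (hφ k) (J.angle_mem k).2 rfl rfl
  change 0 ≤ 1 - J.b φ k ^ 2 at hb
  change 0 ≤ J.b φ k ^ 2 - J.a φ k ^ 2 at ha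
  have hb2 : (√(1 - J.b φ k ^ 2) : ℂ) * √(1 - J.b φ k ^ 2) = 1 - (J.b φ k : ℂ) ^ 2 := by
    exact_mod_cast Real.mul_self_sqrt hb
  have ha2 : (√(J.b φ k ^ 2 - J.a φ k ^ 2) : ℂ) * √(J.b φ k ^ 2 - J.a φ k ^ 2) =
      (J.b φ k : ℂ) ^ 2 - (J.a φ k : ℂ) ^ 2 := by
    exact_mod_cast Real.mul_self_sqrt ha
  have hs : star (J.kraus₁ φ k) = J.kraus₁ φ k := by
    simp [kraus₁, star_proj, star_smul]
  have h11 := J.inner_ψ₁_ψ₁ k k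
  rw [if_pos rfl] at h11
  rw [hs, kraus₂, ContinuousLinearMap.star_eq_adjoint, InnerProductSpace.adjoint_rankOne,
    ContinuousLinearMap.mul_def, ContinuousLinearMap.mul_def,
    InnerProductSpace.rankOne_comp_rankOne]
  ext x
  rcases J.ψPerp_eq_zero_or k with ⟨h, -⟩ | h
  · simp [kraus₁, h, proj_apply, J.norm_ψ₁]
  · simp only [kraus₁, ContinuousLinearMap.comp_apply, add_apply, smul_apply, proj_apply,
      InnerProductSpace.rankOne_apply, inner_add_left, inner_add_right, inner_smul_left,
      inner_smul_right, Complex.conj_ofReal, h, h11, J.inner_ψ₁_ψPerp, J.inner_ψPerp_ψ₁, mul_zero,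
      mul_one, add_zero, zero_add, hb2, ha2]
    module

/-- Identifies `A₃` as the orthogonal projection onto the complement of all Jordan planes. Hence
`A₃† A₃ = A₃`, which makes `shrink` trace preserving. -/
lemma kraus₃_eq (h0 : 0 ≤ φ) (hφ : ∀ k, φ ≤ J.angle k) :
    J.kraus₃ φ = 1 - ∑ k, (proj (J.ψ₁ k) + proj (J.ψPerp k)) := by
  rw [kraus₃, sub_sub, ← Finset.sum_add_distrib]
  simp only [J.star_mul_kraus h0 hφ]

lemma star_kraus₃ : star (J.kraus₃ φ) = J.kraus₃ φ := by
  simp [kraus₃]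

lemma kraus₃_apply (h0 : 0 ≤ φ) (hφ : ∀ k, φ ≤ J.angle k) (x : H) : J.kraus₃ φ x =
    x - ∑ k, (⟪J.ψ₁ k, x⟫_ℂ • J.ψ₁ k + ⟪J.ψPerp k, x⟫_ℂ • J.ψPerp k) := by
  rw [J.kraus₃_eq h0 hφ]
  simp [proj_apply]

lemma kraus₃_ψ₁ (h0 : 0 ≤ φ) (hφ : ∀ k, φ ≤ J.angle k) (k) : J.kraus₃ φ (J.ψ₁ k) = 0 := by
  rw [J.kraus₃_apply h0 hφ]
  simp [J.inner_ψPerp_ψ₁, J.inner_ψ₁_ψ₁]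

lemma kraus₃_ψPerp (h0 : 0 ≤ φ) (hφ : ∀ k, φ ≤ J.angle k) (k) : J.kraus₃ φ (J.ψPerp k) = 0 := by
  rw [J.kraus₃_apply h0 hφ]
  simp [J.inner_ψ₁_ψPerp, J.inner_ψPerp_ψPerp_smul]

lemma kraus₃_mul_self (h0 : 0 ≤ φ) (hφ : ∀ k, φ ≤ J.angle k) :
    J.kraus₃ φ * J.kraus₃ φ = J.kraus₃ φ := by
  ext x
  rw [mul_apply_eq_comp]
  nth_rw 2 [J.kraus₃_apply h0 hφ]
  simp [J.kraus₃_ψ₁ h0 hφ, J.kraus₃_ψPerp h0 hφ]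

lemma inner_ψ₁_kraus₃ (h0 : 0 ≤ φ) (hφ : ∀ k, φ ≤ J.angle k) (k) (x : H) :
    ⟪J.ψ₁ k, J.kraus₃ φ x⟫_ℂ = 0 := by
  rw [← J.star_kraus₃, ContinuousLinearMap.star_eq_adjoint,
    ContinuousLinearMap.adjoint_inner_right, J.kraus₃_ψ₁ h0 hφ, inner_zero_left]

lemma inner_ψPerp_kraus₃ (h0 : 0 ≤ φ) (hφ : ∀ k, φ ≤ J.angle k) (k) (x : H) :
    ⟪J.ψPerp k, J.kraus₃ φ x⟫_ℂ = 0 := by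
  rw [← J.star_kraus₃, ContinuousLinearMap.star_eq_adjoint,
    ContinuousLinearMap.adjoint_inner_right, J.kraus₃_ψPerp h0 hφ, inner_zero_left]

lemma isCPTP_shrink (h0 : 0 ≤ φ) (hφ : ∀ k, φ ≤ J.angle k) : IsCPTP (J.shrink φ) := by
  refine ⟨((isCP_krausMap _).add (isCP_krausMap _)).add (isCP_krausMap _), fun χ => ?_⟩
  rw [shrink, LinearMap.add_apply, LinearMap.add_apply, opTrace_add, opTrace_add, opTrace_krausMap,
    opTrace_krausMap, opTrace_krausMap, ← opTrace_add, ← opTrace_add, ← add_mul, ← add_mul]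
  simp only [← ContinuousLinearMap.star_eq_adjoint, ← ContinuousLinearMap.mul_def,
    Finset.univ_unique, Finset.sum_const, Finset.card_singleton, one_smul, J.star_kraus₃,
    J.kraus₃_mul_self h0 hφ]
  rw [kraus₃, sub_sub, add_sub_cancel, one_mul]

lemma shrink_proj (x : H) : J.shrink φ (proj x) = ∑ k, proj (J.kraus₁ φ k x) +
    ∑ k, proj (J.kraus₂ φ k x) + proj (J.kraus₃ φ x) := by
  simp [shrink, krausMap_proj]

lemma kraus₁_of_mem_left (k) {x : H} (hx : x ∈ A₁) :
    J.kraus₁ φ k x = ⟪J.ψ₁ k, x⟫_ℂ • J.ψ₁ k := by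
  simp [kraus₁, proj_apply, J.inner_ψPerp_of_mem_left k hx]

lemma kraus₂_of_mem_left (k) {x : H} (hx : x ∈ A₁) : J.kraus₂ φ k x = 0 := by
  simp [kraus₂, J.inner_ψPerp_of_mem_left k hx]

/-- `Ω̃` turns the Jordan vectors `ψ₂ k` into vectors enclosing the angle `φ` with `ψ₁ k`. -/
lemma exists_kraus_of_mem_right (h0 : 0 ≤ φ) (hφ : ∀ k, φ ≤ J.angle k) (k) :
    ∃ α β : ℝ, ∀ y ∈ A₂,
      J.kraus₁ φ k y = (⟪J.ψ₂ k, y⟫_ℂ * α) •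
        ((Real.cos φ : ℂ) • J.ψ₁ k + (Real.sin φ : ℂ) • J.ψPerp k) ∧
      J.kraus₂ φ k y = (⟪J.ψ₂ k, y⟫_ℂ * β) •
        ((Real.cos φ : ℂ) • J.ψ₁ k + (Real.sin φ : ℂ) • J.ψPerp k) := by
  obtain ⟨-, -, α, β, e1, e2, e3, e4⟩ :=
    exists_shrink_coeff h0 (hφ k) (J.angle_mem k).2 rfl rfl
  change J.a φ k * _ = _ at e2
  change √(1 - J.b φ k ^ 2) * _ = _ at e3
  change √(J.b φ k ^ 2 - J.a φ k ^ 2) * _ = _ at e4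
  refine ⟨α, β, fun y hy => ⟨?_, ?_⟩⟩
  · rw [kraus₁, add_apply, smul_apply, proj_apply, proj_apply, J.inner_ψ₁_of_mem k hy,
      J.inner_ψPerp_of_mem_right k hy, smul_smul, ← mul_assoc, ← Complex.ofReal_mul, e1, e2]
    push_cast
    module
  · rw [kraus₂, InnerProductSpace.rankOne_apply, J.inner_ψPerp_of_mem_right k hy, mul_comm,
      ← smul_smul, smul_add, smul_smul, smul_smul, ← Complex.ofReal_mul, ← Complex.ofReal_mul,
      mul_comm (Real.sin _), e3, mul_comm (Real.sin _), e4]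
    push_cast
    module

/-- In the support of smaller dimension every basis vector has a partner and so lies in a Jordan
plane, which `A₃` annihilates. -/
lemma kraus₃_of_mem_left (h0 : 0 ≤ φ) (hφ : ∀ k, φ ≤ J.angle k)
    (hr : finrank ℂ A₁ ≤ finrank ℂ A₂) {x : H} (hx : x ∈ A₁) : J.kraus₃ φ x = 0 := by
  have ex : x = ∑ k, J.basis₁.repr ⟨x, hx⟩ k • (J.basis₁ k : H) := by
    simpa using (congrArg Subtype.val (J.basis₁.sum_repr ⟨x, hx⟩)).symm
  rw [ex, map_sum]
  refine Finset.sum_eq_zero fun k _ => ?_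
  have hk : (J.basis₁ k : H) = J.ψ₁ ⟨k, lt_min k.2 (k.2.trans_le hr)⟩ := rfl
  rw [map_smul, hk, J.kraus₃_ψ₁ h0 hφ, smul_zero]

lemma kraus₃_of_mem_right (h0 : 0 ≤ φ) (hφ : ∀ k, φ ≤ J.angle k)
    (hr : finrank ℂ A₂ ≤ finrank ℂ A₁) {y : H} (hy : y ∈ A₂) : J.kraus₃ φ y = 0 := by
  have ey : y = ∑ k, J.basis₂.repr ⟨y, hy⟩ k • (J.basis₂ k : H) := by
    simpa using (congrArg Subtype.val (J.basis₂.sum_repr ⟨y, hy⟩)).symm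
  rw [ey, map_sum]
  refine Finset.sum_eq_zero fun k _ => ?_
  have hk : (J.basis₂ k : H) = J.ψ₂ ⟨k, lt_min (k.2.trans_le hr) k.2⟩ := rfl
  rw [map_smul, hk, J.ψ₂_eq, map_add, map_smul, map_smul, J.kraus₃_ψ₁ h0 hφ, J.kraus₃_ψPerp h0 hφ,
    smul_zero, smul_zero, add_zero, smul_zero]

end Shrink

end JordanBases

/-! ### Classical labels tensored with a fixed pure state. -/

section Mixture

variable {H : Type*} [NormedAddCommGroup H] [InnerProductSpace ℂ H] [CompleteSpace H]
  [FiniteDimensional ℂ H]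
  {K : Type*} [NormedAddCommGroup K] [InnerProductSpace ℂ K] [CompleteSpace K]
  [FiniteDimensional ℂ K]

lemma adjoint_rankOne_comp_rankOne (x y : H) (z w : K) :
    ContinuousLinearMap.adjoint (InnerProductSpace.rankOne ℂ z x) ∘L
      InnerProductSpace.rankOne ℂ w y = ⟪z, w⟫_ℂ • InnerProductSpace.rankOne ℂ x y := by
  rw [InnerProductSpace.adjoint_rankOne, InnerProductSpace.rankOne_comp_rankOne]

lemma proj_smul (c : ℂ) (x : H) : proj (c • x) = ((‖c‖ ^ 2 : ℝ) : ℂ) • proj x := by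
  ext y
  simp only [smul_apply, proj_apply, inner_smul_left, smul_smul]
  congr 1
  push_cast
  rw [← Complex.conj_mul']
  ring

lemma proj_zero : proj (0 : H) = 0 := by
  simp [proj]

/-- For `x` in the kernel, `0 = ⟨x, ρ x⟩ = ∑ |⟨x, w i⟩|²`, so each `w i` is orthogonal to the
kernel. This reduces claims about `ρ` to projectors of vectors in its support. -/
lemma exists_eq_sum_proj_mem_supp {ρ : H →L[ℂ] H} (hρ : 0 ≤ ρ) :
    ∃ (m : ℕ) (w : Fin m → H), (∀ i, w i ∈ supp ρ) ∧ ρ = ∑ i, proj (w i) := by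
  obtain ⟨m, w, rfl⟩ := exists_eq_sum_proj hρ
  refine ⟨m, w, fun i => (Submodule.mem_orthogonal _ _).2 fun x hx => ?_, rfl⟩
  have h : (⟪x, (∑ i, proj (w i)) x⟫_ℂ).re = 0 := by
    rw [show (∑ i, proj (w i)) x = 0 from hx, inner_zero_right, Complex.zero_re]
  have hterm : ∀ j, (⟪x, proj (w j) x⟫_ℂ).re = ‖⟪x, w j⟫_ℂ‖ ^ 2 := fun j => by
    rw [proj_apply, inner_smul_right, ← inner_conj_symm (w j) x, Complex.conj_mul',
      ← Complex.ofReal_pow, Complex.ofReal_re]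
  rw [sum_apply, inner_sum, Complex.re_sum] at h
  simp only [hterm] at h
  simpa using (Finset.sum_eq_zero_iff_of_nonneg fun j _ => sq_nonneg _).1 h i (Finset.mem_univ _)

/-- The operators `∑ k, p k |k⟩⟨k| ⊗ |η⟩⟨η|`. -/
def classicalTensor {n : ℕ} (e : OrthonormalBasis (Fin n) ℂ H) (η : K) :
    AddSubmonoid (H ⊗[ℂ] K →L[ℂ] H ⊗[ℂ] K) where
  carrier := {T | ∃ p : Fin n → ℝ, T = ∑ k, (p k : ℂ) • proj (e k ⊗ₜ[ℂ] η)}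
  zero_mem' := ⟨0, by simp⟩
  add_mem' := by
    rintro _ _ ⟨p, rfl⟩ ⟨q, rfl⟩
    exact ⟨p + q, by simp [add_smul, Finset.sum_add_distrib]⟩

lemma proj_smul_mem_classicalTensor {n : ℕ} (e : OrthonormalBasis (Fin n) ℂ H) (η : K) (c : ℂ)
    (k : Fin n) : proj (c • (e k ⊗ₜ[ℂ] η)) ∈ classicalTensor e η := by
  refine ⟨fun j => if j = k then ‖c‖ ^ 2 else 0, ?_⟩
  rw [Finset.sum_eq_single k]
  · simp [proj_smul]
  · intro j _ hj
    simp [hj]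
  · simp

lemma partialTrace_of_mem_classicalTensor {n : ℕ} (e : OrthonormalBasis (Fin n) ℂ H) {η : K}
    (hη : ‖η‖ = 1) {T : H ⊗[ℂ] K →L[ℂ] H ⊗[ℂ] K} (hT : T ∈ classicalTensor e η)
    (htr : opTrace T = 1) : partialTrace T = proj η := by
  obtain ⟨p, rfl⟩ := hT
  have h : partialTrace (∑ k, (p k : ℂ) • proj (e k ⊗ₜ[ℂ] η)) = (∑ k, (p k : ℂ)) • proj η := by
    simp only [map_sum, map_smul, partialTrace_proj_tmul (e.norm_eq_one _), Finset.sum_smul]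
  -- The coefficients sum to one because the partial trace preserves the trace.
  rw [← isCPTP_partialTrace.2, h, opTrace_smul, opTrace_proj, hη] at htr
  rw [h, show ∑ k, (p k : ℂ) = 1 by simpa using htr, one_smul]

lemma exists_orthonormal_pair (hK : 2 ≤ finrank ℂ K) :
    ∃ η ζ : K, ‖η‖ = 1 ∧ ‖ζ‖ = 1 ∧ ⟪η, ζ⟫_ℂ = 0 := by
  have b := stdOrthonormalBasis ℂ K
  refine ⟨b ⟨0, by omega⟩, b ⟨1, by omega⟩, b.norm_eq_one _, b.norm_eq_one _, b.inner_eq_zero ?_⟩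
  simp

end Mixture

/-! ### The encoding into label and fixed plane. -/

namespace JordanBases

section Encode

variable {H : Type*} [NormedAddCommGroup H] [InnerProductSpace ℂ H] [CompleteSpace H]
  [FiniteDimensional ℂ H]
  {K : Type*} [NormedAddCommGroup K] [InnerProductSpace ℂ K] [CompleteSpace K]
  [FiniteDimensional ℂ K]
  {A₁ A₂ : Submodule ℂ H} (J : JordanBases A₁ A₂) {φ : ℝ}

/-- The member of the standard basis of `H` that labels the `k`-th pair of Jordan vectors. -/
noncomputable def label (_ : JordanBases A₁ A₂) (k : Fin (min (finrank ℂ A₁) (finrank ℂ A₂))) :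
    Fin (finrank ℂ H) :=
  k.castLE ((min_le_left _ _).trans A₁.finrank_le)

/-- The Kraus operator `|k⟩ ⊗ (|η⟩⟨ψ₁ k| + |ζ⟩⟨ψ₁⊥ k|)`. -/
noncomputable def encodePair (η ζ : K) (k : Fin (min (finrank ℂ A₁) (finrank ℂ A₂))) : H →L[ℂ] H ⊗[ℂ] K :=
  InnerProductSpace.rankOne ℂ (stdOrthonormalBasis ℂ H (J.label k) ⊗ₜ[ℂ] η) (J.ψ₁ k) +
    InnerProductSpace.rankOne ℂ (stdOrthonormalBasis ℂ H (J.label k) ⊗ₜ[ℂ] ζ) (J.ψPerp k)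

/-- The Kraus operator `|j⟩ ⊗ |χ⟩⟨j| A₃`. -/
noncomputable def encodeRest (φ : ℝ) (χ : K) (j : Fin (finrank ℂ H)) : H →L[ℂ] H ⊗[ℂ] K :=
  InnerProductSpace.rankOne ℂ (stdOrthonormalBasis ℂ H j ⊗ₜ[ℂ] χ)
    (J.kraus₃ φ (stdOrthonormalBasis ℂ H j))

/-- The map that moves the two-dimensional spaces spanned by the Jordan vectors to the second tensor
factor and replaces what is orthogonal to all of them by `χ`. -/
noncomputable def encode (φ : ℝ) (η ζ χ : K) : (H →L[ℂ] H) →ₗ[ℂ] (H ⊗[ℂ] K →L[ℂ] H ⊗[ℂ] K) :=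
  krausMap (J.encodePair η ζ) + krausMap (J.encodeRest φ χ)

lemma inner_std_tmul (j : Fin (finrank ℂ H)) (y z : K) :
    ⟪stdOrthonormalBasis ℂ H j ⊗ₜ[ℂ] y, stdOrthonormalBasis ℂ H j ⊗ₜ[ℂ] z⟫_ℂ = ⟪y, z⟫_ℂ := by
  simp

lemma adjoint_encodePair_comp {η ζ : K} (hη : ‖η‖ = 1) (hζ : ‖ζ‖ = 1) (hηζ : ⟪η, ζ⟫_ℂ = 0) (k) :
    ContinuousLinearMap.adjoint (J.encodePair η ζ k) ∘L J.encodePair η ζ k =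
      proj (J.ψ₁ k) + proj (J.ψPerp k) := by
  have hζη : ⟪ζ, η⟫_ℂ = 0 := inner_eq_zero_symm.1 hηζ
  rw [encodePair, map_add, ContinuousLinearMap.add_comp, ContinuousLinearMap.comp_add,
    ContinuousLinearMap.comp_add, adjoint_rankOne_comp_rankOne, adjoint_rankOne_comp_rankOne,
    adjoint_rankOne_comp_rankOne, adjoint_rankOne_comp_rankOne, inner_std_tmul, inner_std_tmul,
    inner_std_tmul, inner_std_tmul, hηζ, hζη, inner_self_eq_norm_sq_to_K,
    inner_self_eq_norm_sq_to_K, hη, hζ]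
  simp [proj]

/-- Since `A₃` is self-adjoint, the sum is `∑ j, ⟨j, A₃ x⟩ A₃ |j⟩ = A₃ (A₃ x)`, and `A₃` is
idempotent. -/
lemma sum_adjoint_encodeRest_comp (h0 : 0 ≤ φ) (hφ : ∀ k, φ ≤ J.angle k) {χ : K} (hχ : ‖χ‖ = 1) :
    ∑ j, ContinuousLinearMap.adjoint (J.encodeRest φ χ j) ∘L J.encodeRest φ χ j = J.kraus₃ φ := by
  rw [← J.kraus₃_mul_self h0 hφ]
  ext x
  have h : ∀ j, ⟪J.kraus₃ φ (stdOrthonormalBasis ℂ H j), x⟫_ℂ =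
      ⟪stdOrthonormalBasis ℂ H j, J.kraus₃ φ x⟫_ℂ := fun j => by
    conv_rhs => rw [← J.star_kraus₃, ContinuousLinearMap.star_eq_adjoint,
      ContinuousLinearMap.adjoint_inner_right]
  simp only [encodeRest, adjoint_rankOne_comp_rankOne, inner_std_tmul, inner_self_eq_norm_sq_to_K,
    hχ, sum_apply, smul_apply, InnerProductSpace.rankOne_apply, h]
  conv_rhs => rw [mul_apply_eq_comp, ← (stdOrthonormalBasis ℂ H).sum_repr' (J.kraus₃ φ x), map_sum]
  simp

lemma isCPTP_encode (h0 : 0 ≤ φ) (hφ : ∀ k, φ ≤ J.angle k) {η ζ χ : K} (hη : ‖η‖ = 1)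
    (hζ : ‖ζ‖ = 1) (hηζ : ⟪η, ζ⟫_ℂ = 0) (hχ : ‖χ‖ = 1) : IsCPTP (J.encode φ η ζ χ) := by
  refine ⟨(isCP_krausMap _).add (isCP_krausMap _), fun T => ?_⟩
  rw [encode, LinearMap.add_apply, opTrace_add, opTrace_krausMap, opTrace_krausMap, ← opTrace_add,
    ← add_mul, J.sum_adjoint_encodeRest_comp h0 hφ hχ]
  simp only [J.adjoint_encodePair_comp hη hζ hηζ]
  rw [J.kraus₃_eq h0 hφ, add_sub_cancel, one_mul]

lemma encodePair_ψ₁ (η ζ : K) (j k) : J.encodePair η ζ j (J.ψ₁ k) =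
    if j = k then stdOrthonormalBasis ℂ H (J.label j) ⊗ₜ[ℂ] η else 0 := by
  simp [encodePair, J.inner_ψ₁_ψ₁, J.inner_ψPerp_ψ₁]

lemma encodePair_ψPerp (η ζ : K) (j k) : J.encodePair η ζ j (J.ψPerp k) =
    ⟪J.ψPerp j, J.ψPerp k⟫_ℂ • stdOrthonormalBasis ℂ H (J.label j) ⊗ₜ[ℂ] ζ := by
  simp [encodePair, J.inner_ψ₁_ψPerp]

lemma encodePair_kraus₃ (h0 : 0 ≤ φ) (hφ : ∀ k, φ ≤ J.angle k) (η ζ : K) (j) (x : H) :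
    J.encodePair η ζ j (J.kraus₃ φ x) = 0 := by
  simp [encodePair, J.inner_ψ₁_kraus₃ h0 hφ, J.inner_ψPerp_kraus₃ h0 hφ]

lemma encodeRest_eq (χ : K) (j) (x : H) : J.encodeRest φ χ j x =
    ⟪stdOrthonormalBasis ℂ H j, J.kraus₃ φ x⟫_ℂ • stdOrthonormalBasis ℂ H j ⊗ₜ[ℂ] χ := by
  rw [encodeRest, InnerProductSpace.rankOne_apply]
  congr 1
  conv_rhs => rw [← J.star_kraus₃, ContinuousLinearMap.star_eq_adjoint,
    ContinuousLinearMap.adjoint_inner_right]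

/-- The output vector is `κ` as soon as every pair operator yields a multiple of `κ` and the
remainder either is sent to `κ` or is absent. -/
lemma encode_proj_mem {η ζ χ κ : K} {x : H}
    (hp : ∀ j, ∃ c : ℂ, J.encodePair η ζ j x = c • stdOrthonormalBasis ℂ H (J.label j) ⊗ₜ[ℂ] κ)
    (hr : χ = κ ∨ J.kraus₃ φ x = 0) :
    J.encode φ η ζ χ (proj x) ∈ classicalTensor (stdOrthonormalBasis ℂ H) κ := by
  rw [encode, LinearMap.add_apply, krausMap_proj, krausMap_proj]
  refine add_mem (sum_mem fun j _ => ?_) (sum_mem fun j _ => ?_)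
  · obtain ⟨c, hc⟩ := hp j
    rw [hc]
    exact proj_smul_mem_classicalTensor _ _ _ _
  · rw [encodeRest_eq]
    rcases hr with rfl | hr
    · exact proj_smul_mem_classicalTensor _ _ _ _
    · rw [hr, inner_zero_right, zero_smul, proj_zero]
      exact zero_mem _

lemma encode_shrink_mem_left (h0 : 0 ≤ φ) (hφ : ∀ k, φ ≤ J.angle k) {η ζ χ : K}
    (hχ : χ = η ∨ finrank ℂ A₁ ≤ finrank ℂ A₂) {x : H} (hx : x ∈ A₁) :
    J.encode φ η ζ χ (J.shrink φ (proj x)) ∈ classicalTensor (stdOrthonormalBasis ℂ H) η := by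
  simp only [J.shrink_proj, J.kraus₁_of_mem_left _ hx, J.kraus₂_of_mem_left _ hx, proj_zero,
    Finset.sum_const_zero, add_zero, map_add, map_sum]
  refine add_mem (sum_mem fun k _ => J.encode_proj_mem (fun j => ?_) (.inr ?_))
    (J.encode_proj_mem (fun j => ⟨0, ?_⟩) ?_)
  · rw [map_smul, encodePair_ψ₁]
    split_ifs with h
    · exact ⟨_, rfl⟩
    · exact ⟨0, by simp⟩
  · rw [map_smul, J.kraus₃_ψ₁ h0 hφ, smul_zero]
  · rw [J.encodePair_kraus₃ h0 hφ, zero_smul]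
  · refine hχ.imp_right fun h => ?_
    rw [J.kraus₃_of_mem_left h0 hφ h hx, map_zero]

lemma encode_shrink_mem_right (h0 : 0 ≤ φ) (hφ : ∀ k, φ ≤ J.angle k) {η ζ χ : K}
    (hχ : χ = (Real.cos φ : ℂ) • η + (Real.sin φ : ℂ) • ζ ∨ finrank ℂ A₂ ≤ finrank ℂ A₁)
    {y : H} (hy : y ∈ A₂) : J.encode φ η ζ χ (J.shrink φ (proj y)) ∈
      classicalTensor (stdOrthonormalBasis ℂ H)
        ((Real.cos φ : ℂ) • η + (Real.sin φ : ℂ) • ζ) := by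
  have hpair : ∀ (c : ℂ) (k), J.encode φ η ζ χ (proj (c •
      ((Real.cos φ : ℂ) • J.ψ₁ k + (Real.sin φ : ℂ) • J.ψPerp k))) ∈
      classicalTensor (stdOrthonormalBasis ℂ H)
        ((Real.cos φ : ℂ) • η + (Real.sin φ : ℂ) • ζ) := fun c k => by
    refine J.encode_proj_mem (fun j => ?_) (.inr ?_)
    · rw [map_smul, map_add, map_smul, map_smul, encodePair_ψ₁, encodePair_ψPerp]
      by_cases h : j = k
      · subst h
        refine ⟨c, ?_⟩
        rw [if_pos rfl, TensorProduct.tmul_add, TensorProduct.tmul_smul, TensorProduct.tmul_smul]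
        rcases J.ψPerp_eq_zero_or j with ⟨-, hs⟩ | h
        -- If `ψPerp j = 0`, its image cannot supply the `ζ` component. But then `sin ϑ_j = 0`, and
        -- `φ ≤ ϑ_j` makes this component vanish.
        · have hsin : Real.sin φ = 0 := by
            refine le_antisymm ?_ (Real.sin_nonneg_of_nonneg_of_le_pi h0 ?_)
            · rw [← hs]
              exact Real.sin_le_sin_of_le_of_le_pi_div_two (by linarith [Real.pi_pos])
                (J.angle_mem j).2 (hφ j)
            · linarith [(J.angle_mem j).2, hφ j, Real.pi_pos]
          rw [hsin, Complex.ofReal_zero, zero_smul, zero_smul]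
        · rw [h, one_smul]
      · refine ⟨0, ?_⟩
        rw [if_neg h, inner_ψPerp_ψPerp_eq, if_neg h]
        simp
    · rw [map_smul, map_add, map_smul, map_smul, J.kraus₃_ψ₁ h0 hφ, J.kraus₃_ψPerp h0 hφ]
      simp
  rw [J.shrink_proj, map_add, map_add, map_sum, map_sum]
  refine add_mem (add_mem (sum_mem fun k _ => ?_) (sum_mem fun k _ => ?_))
    (J.encode_proj_mem (fun j => ⟨0, ?_⟩) ?_)
  · obtain ⟨α, β, h⟩ := J.exists_kraus_of_mem_right h0 hφ k
    rw [(h y hy).1]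
    exact hpair _ k
  · obtain ⟨α, β, h⟩ := J.exists_kraus_of_mem_right h0 hφ k
    rw [(h y hy).2]
    exact hpair _ k
  · rw [J.encodePair_kraus₃ h0 hφ, zero_smul]
  · refine hχ.imp_right fun h => ?_
    rw [J.kraus₃_of_mem_right h0 hφ h hy, map_zero]

end Encode

end JordanBases

/-! ### The optimal map attains the bound. -/

section Optimal

variable {H : Type*} [NormedAddCommGroup H] [InnerProductSpace ℂ H] [CompleteSpace H]
  [FiniteDimensional ℂ H] {ρ₁ ρ₂ : H →L[ℂ] H}

lemma sin_arcsin_wcd (h₁ : IsState ρ₁) (h₂ : IsState ρ₂)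
    (J : JordanBases (supp ρ₁) (supp ρ₂)) :
    Real.sin (Real.arcsin (wcd ρ₁ ρ₂)) = wcd ρ₁ ρ₂ := by
  obtain ⟨k, hk⟩ := (J.isLeast_wcd h₁ h₂).1
  rw [← hk]
  exact Real.sin_arcsin (Real.neg_one_le_sin _) (Real.sin_le_one _)

lemma arcsin_wcd_nonneg (h₁ : IsState ρ₁) (h₂ : IsState ρ₂)
    (J : JordanBases (supp ρ₁) (supp ρ₂)) : 0 ≤ Real.arcsin (wcd ρ₁ ρ₂) := by
  obtain ⟨k, hk⟩ := (J.isLeast_wcd h₁ h₂).1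
  rw [Real.arcsin_nonneg, ← hk]
  exact J.sin_angle_nonneg k

lemma arcsin_wcd_le_angle (h₁ : IsState ρ₁) (h₂ : IsState ρ₂)
    (J : JordanBases (supp ρ₁) (supp ρ₂)) (k) : Real.arcsin (wcd ρ₁ ρ₂) ≤ J.angle k := by
  rw [← Real.arcsin_sin (x := J.angle k) (by linarith [(J.angle_mem k).1, Real.pi_pos])
    (J.angle_mem k).2]
  exact Real.arcsin_le_arcsin ((J.isLeast_wcd h₁ h₂).2 ⟨k, rfl⟩)

/-- The shrinking map, followed by a suitable encoding and a partial trace, purifies both states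
and attains the worst-case distinguishability. -/
lemma exists_encode (h₁ : IsState ρ₁) (h₂ : IsState ρ₂) (J : JordanBases (supp ρ₁) (supp ρ₂))
    (K : Type*) [NormedAddCommGroup K] [InnerProductSpace ℂ K] [CompleteSpace K]
    [FiniteDimensional ℂ K] (hK : 2 ≤ finrank ℂ K) :
    ∃ (E : (H →L[ℂ] H) →ₗ[ℂ] (H ⊗[ℂ] K →L[ℂ] H ⊗[ℂ] K))
      (e : OrthonormalBasis (Fin (finrank ℂ H)) ℂ H)
      (p₁ p₂ : Fin (finrank ℂ H) → ℝ) (φ₁ φ₂ : K),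
      IsCPTP E ∧ ‖φ₁‖ = 1 ∧ ‖φ₂‖ = 1 ∧
      traceDist (proj φ₁) (proj φ₂) = wcd ρ₁ ρ₂ ∧
      E (J.shrink (Real.arcsin (wcd ρ₁ ρ₂)) ρ₁) = ∑ k, (p₁ k : ℂ) • proj (e k ⊗ₜ[ℂ] φ₁) ∧
      E (J.shrink (Real.arcsin (wcd ρ₁ ρ₂)) ρ₂) = ∑ k, (p₂ k : ℂ) • proj (e k ⊗ₜ[ℂ] φ₂) ∧
      IsCPTP (partialTrace ∘ₗ E ∘ₗ J.shrink (Real.arcsin (wcd ρ₁ ρ₂))) ∧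
      (partialTrace ∘ₗ E ∘ₗ J.shrink (Real.arcsin (wcd ρ₁ ρ₂))) ρ₁ = proj φ₁ ∧
      (partialTrace ∘ₗ E ∘ₗ J.shrink (Real.arcsin (wcd ρ₁ ρ₂))) ρ₂ = proj φ₂ := by
  have h0 := arcsin_wcd_nonneg h₁ h₂ J
  have hφ := arcsin_wcd_le_angle h₁ h₂ J
  have hsin := sin_arcsin_wcd h₁ h₂ J
  set φ := Real.arcsin (wcd ρ₁ ρ₂)
  obtain ⟨η, ζ, hη, hζ, hηζ⟩ := exists_orthonormal_pair hK
  have hηη : ⟪η, η⟫_ℂ = 1 := by simp [inner_self_eq_norm_sq_to_K, hη]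
  have hζζ : ⟪ζ, ζ⟫_ℂ = 1 := by simp [inner_self_eq_norm_sq_to_K, hζ]
  set κ := (Real.cos φ : ℂ) • η + (Real.sin φ : ℂ) • ζ with hκdef
  have hηκ : ⟪η, κ⟫_ℂ = Real.cos φ := by
    rw [hκdef, inner_add_right, inner_smul_right, inner_smul_right, hηη, hηζ]
    simp
  have hκ : ‖κ‖ = 1 := by
    have h : ⟪κ, κ⟫_ℂ = ((Real.cos φ ^ 2 + Real.sin φ ^ 2 : ℝ) : ℂ) := by
      rw [hκdef]
      simp only [inner_add_left, inner_add_right, inner_smul_left, inner_smul_right,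
        Complex.conj_ofReal, hηη, hζζ, hηζ, inner_eq_zero_symm.1 hηζ]
      push_cast
      ring
    rw [Real.cos_sq_add_sin_sq, inner_self_eq_norm_sq_to_K] at h
    exact (pow_eq_one_iff_of_nonneg (norm_nonneg κ) two_ne_zero).1
      (by simpa using congrArg norm h)
  -- Only the larger support can reach the range of `A₃`, so `χ` is chosen as the target vector of
  -- that support; for equal dimensions either choice works.
  obtain ⟨χ, hχ, hχ₁, hχ₂⟩ : ∃ χ : K, ‖χ‖ = 1 ∧
      (χ = η ∨ finrank ℂ (supp ρ₁) ≤ finrank ℂ (supp ρ₂)) ∧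
      (χ = κ ∨ finrank ℂ (supp ρ₂) ≤ finrank ℂ (supp ρ₁)) := by
    rcases le_total (finrank ℂ (supp ρ₁)) (finrank ℂ (supp ρ₂)) with h | h
    exacts [⟨κ, hκ, .inr h, .inl rfl⟩, ⟨η, hη, .inl rfl, .inr h⟩]
  have hE := J.isCPTP_encode h0 hφ hη hζ hηζ hχ
  have hS := J.isCPTP_shrink h0 hφ
  have hm₁ : J.encode φ η ζ χ (J.shrink φ ρ₁) ∈ classicalTensor (stdOrthonormalBasis ℂ H) η := by
    obtain ⟨m, w, hw, e⟩ := exists_eq_sum_proj_mem_supp h₁.1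
    rw [congrArg (J.shrink φ) e, map_sum, map_sum]
    exact sum_mem fun i _ => J.encode_shrink_mem_left h0 hφ hχ₁ (hw i)
  have hm₂ : J.encode φ η ζ χ (J.shrink φ ρ₂) ∈ classicalTensor (stdOrthonormalBasis ℂ H) κ := by
    obtain ⟨m, w, hw, e⟩ := exists_eq_sum_proj_mem_supp h₂.1
    rw [congrArg (J.shrink φ) e, map_sum, map_sum]
    exact sum_mem fun i _ => J.encode_shrink_mem_right h0 hφ hχ₂ (hw i)
  obtain ⟨p₁, hp₁⟩ := id hm₁
  obtain ⟨p₂, hp₂⟩ := id hm₂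
  refine ⟨J.encode φ η ζ χ, stdOrthonormalBasis ℂ H, p₁, p₂, η, κ, hE, hη, hκ, ?_, hp₁, hp₂,
    isCPTP_partialTrace.comp (hE.comp hS), partialTrace_of_mem_classicalTensor _ hη hm₁ ?_,
    partialTrace_of_mem_classicalTensor _ hκ hm₂ ?_⟩
  · rw [traceDist_proj hη hκ, hηκ, Complex.norm_real, Real.norm_eq_abs, sq_abs, ← Real.sin_sq, hsin,
      Real.sqrt_sq]
    rw [← hsin]
    exact Real.sin_nonneg_of_nonneg_of_le_pi h0
      ((Real.arcsin_le_pi_div_two _).trans (by linarith [Real.pi_pos]))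
  · exact ((hE.comp hS).isState h₁).2
  · exact ((hE.comp hS).isState h₂).2

end Optimal

end Purify

theorem mainTheorem2 {H : Type u} [NormedAddCommGroup H] [InnerProductSpace ℂ H]
    [CompleteSpace H] [FiniteDimensional ℂ H]
    (ρ₁ ρ₂ : H →L[ℂ] H) (h₁ : Purify.IsState ρ₁) (h₂ : Purify.IsState ρ₂) :
    -- the upper bound and the maximum
    (∀ (K : Type v) [NormedAddCommGroup K] [InnerProductSpace ℂ K] [CompleteSpace K]
        [FiniteDimensional ℂ K] (Λ : (H →L[ℂ] H) →ₗ[ℂ] (K →L[ℂ] K)),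
        Purify.IsCPTP Λ → {ρ₁, ρ₂} ⊆ Purify.Pur Λ →
          Purify.traceDist (Λ ρ₁) (Λ ρ₂) ≤ Purify.wcd ρ₁ ρ₂) ∧
    IsGreatest
      {t : ℝ | ∃ (K : Type v) (_ : NormedAddCommGroup K) (_ : InnerProductSpace ℂ K)
        (_ : CompleteSpace K) (_ : FiniteDimensional ℂ K)
        (Λ : (H →L[ℂ] H) →ₗ[ℂ] (K →L[ℂ] K)),
        Purify.IsCPTP Λ ∧ {ρ₁, ρ₂} ⊆ Purify.Pur Λ ∧ t = Purify.traceDist (Λ ρ₁) (Λ ρ₂)}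
      (Purify.wcd ρ₁ ρ₂) ∧
    -- Jordan bases of the supports exist, and they give the worst-case distinguishability
    Nonempty (Purify.JordanBases (Purify.supp ρ₁) (Purify.supp ρ₂)) ∧
    ∀ J : Purify.JordanBases (Purify.supp ρ₁) (Purify.supp ρ₂),
      IsLeast (Set.range fun k => Real.sin (J.angle k)) (Purify.wcd ρ₁ ρ₂) ∧
      -- the explicit construction
      Purify.IsCPTP (J.shrink (Real.arcsin (Purify.wcd ρ₁ ρ₂))) ∧
      ∀ (K : Type v) [NormedAddCommGroup K] [InnerProductSpace ℂ K] [CompleteSpace K]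
        [FiniteDimensional ℂ K], 2 ≤ finrank ℂ K →
        ∃ (E : (H →L[ℂ] H) →ₗ[ℂ] (H ⊗[ℂ] K →L[ℂ] H ⊗[ℂ] K))
          (e : OrthonormalBasis (Fin (finrank ℂ H)) ℂ H)
          (p₁ p₂ : Fin (finrank ℂ H) → ℝ) (φ₁ φ₂ : K),
          Purify.IsCPTP E ∧ ‖φ₁‖ = 1 ∧ ‖φ₂‖ = 1 ∧
          Purify.traceDist (Purify.proj φ₁) (Purify.proj φ₂) = Purify.wcd ρ₁ ρ₂ ∧
          E (J.shrink (Real.arcsin (Purify.wcd ρ₁ ρ₂)) ρ₁) =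
            ∑ k, (p₁ k : ℂ) • Purify.proj (e k ⊗ₜ[ℂ] φ₁) ∧
          E (J.shrink (Real.arcsin (Purify.wcd ρ₁ ρ₂)) ρ₂) =
            ∑ k, (p₂ k : ℂ) • Purify.proj (e k ⊗ₜ[ℂ] φ₂) ∧
          Purify.IsCPTP
            (Purify.partialTrace ∘ₗ E ∘ₗ J.shrink (Real.arcsin (Purify.wcd ρ₁ ρ₂))) ∧
          (Purify.partialTrace ∘ₗ E ∘ₗ J.shrink (Real.arcsin (Purify.wcd ρ₁ ρ₂))) ρ₁ =
            Purify.proj φ₁ ∧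
          (Purify.partialTrace ∘ₗ E ∘ₗ J.shrink (Real.arcsin (Purify.wcd ρ₁ ρ₂))) ρ₂ =
            Purify.proj φ₂ := by
  refine ⟨fun K _ _ _ _ Λ hΛ h => Purify.traceDist_le_wcd hΛ h, ⟨?_, ?_⟩,
    Purify.nonempty_jordanBases _ _, fun J => ⟨J.isLeast_wcd h₁ h₂, ?_, ?_⟩⟩
  · obtain ⟨J⟩ := Purify.nonempty_jordanBases (Purify.supp ρ₁) (Purify.supp ρ₂)
    obtain ⟨E, -, -, -, φ₁, φ₂, -, hφ₁, hφ₂, hD, -, -, hΛ, e₁, e₂⟩ :=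
      -- A qubit suffices as output space; `ULift` places it in the universe of `K`.
      Purify.exists_encode h₁ h₂ J (EuclideanSpace ℂ (ULift.{v} (Fin 2))) (by simp)
    refine ⟨EuclideanSpace ℂ (ULift.{v} (Fin 2)), inferInstance, inferInstance, inferInstance,
      inferInstance, _, hΛ, ?_, by rw [e₁, e₂, hD]⟩
    rintro ρ (rfl | rfl)
    · exact ⟨h₁, by rw [e₁, Purify.opTrace_proj_sq hφ₁]⟩
    · exact ⟨h₂, by rw [e₂, Purify.opTrace_proj_sq hφ₂]⟩
  · rintro t ⟨K, _, _, _, _, Λ, hΛ, h, rfl⟩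
    exact Purify.traceDist_le_wcd hΛ h
  · exact J.isCPTP_shrink (Purify.arcsin_wcd_nonneg h₁ h₂ J) (Purify.arcsin_wcd_le_angle h₁ h₂ J)
  · exact fun K _ _ _ _ hK => Purify.exists_encode h₁ h₂ J K hK
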